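/- Let $\lambda$ be a probability measure on $\mathbb{R}^+=\{x\in\mathbb{R}: x>0\}$ with finite support, let $\sigma=\int x\,d\lambda(x)$, and write $|\operatorname{supp}\lambda|=\sup\{|x| : x\in\operatorname{supp}\lambda\}$ and $\mathcal{L}\lambda(z)=\int e^{-zx}\,d\lambda(x)$ for $z\in\mathbb{C}$. Let $l>0$ and suppose that $\lambda$ is $l$-weakly diophantine, that is, $$\liminf_{|b|\to\infty}|b|^{l}\,|1-\mathcal{L}\lambda(ib)|>0 .$$ Then there is a constant $C$, depending only on $\lambda$ and $l$, with the following property. Let $X_1,X_2,\dots$ be i.i.d. random variables with distribution $\lambda$, let $S_n=X_1+\dots+X_n$, and for real $t$ let $n_t=\inf\{n\in\mathbb{N} : S_n\ge t\}$. Then for every $t>|\operatorname{supp}\lambda|+1$, $n_t$ is almost surely finite, and for every $C^1$ function $g:\mathbb{R}\to\mathbb{C}$ the random variable $g(S_{n_t}-t)$ is integrable and $$\left|\mathbb{E}\big(g(S_{n_t}-t)\big)-\frac1\sigma\int_0^\infty g(x)\,\lambda((x,\infty))\,dx\right|\le C\,t^{-1/(4l+1)}\,\|g\|_{C^1},$$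 where $\|g\|_{C^1}=\sup\{|g(x)|+|g'(x)| : x\in(-1,|\operatorname{supp}\lambda|+1)\}$. -/

import Mathlib

open MeasureTheory ProbabilityTheory Filter Set

noncomputable section

namespace StoppedRenewal

/-- `|K| = sup {|x| : x ∈ K}`. -/
def supAbs (K : Set ℝ) : ℝ := sSup ((fun x => |x|) '' K)

/-- The Laplace transform `ℒλ(z) = ∫ e^{-zx} dλ(x)`. -/
def laplaceTransform (lam : Measure ℝ) (z : ℂ) : ℂ :=
  ∫ x : ℝ, Complex.exp (-(z * (x : ℂ))) ∂lam

/-- `λ` is `l`-weakly diophantine (`l > 0`): `liminf_{|b| → ∞} |b|^l |1 - ℒλ(ib)| > 0`.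
The lower limit is taken in the extended reals, as it may be `+∞`. -/
def IsWeaklyDiophantine (l : ℝ) (lam : Measure ℝ) : Prop :=
  0 < l ∧
    0 < liminf
      (fun b : ℝ =>
        ((|b| ^ l * ‖1 - laplaceTransform lam (Complex.I * (b : ℂ))‖ : ℝ) : EReal))
      (Bornology.cobounded ℝ)

/-- The local norm `‖g‖_{C¹} = sup {|g(x)| + |g'(x)| : x ∈ (-1, |supp λ| + 1)}`. -/
def localC1Norm (lam : Measure ℝ) (g : ℝ → ℂ) : ℝ :=
  sSup ((fun x => ‖g x‖ + ‖deriv g x‖) '' Ioo (-1) (supAbs lam.support + 1))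

/-- The random walk `S_n = X_1 + ⋯ + X_n`; the step `X_{i+1}` is `X i`. -/
def walk {Ω : Type*} (X : ℕ → Ω → ℝ) (n : ℕ) (ω : Ω) : ℝ :=
  ∑ i ∈ Finset.range n, X i ω

/-- The stopping time `n_t = inf {n : S_n ≥ t}`
(with value `0` at those `ω` where the walk never reaches `t`). -/
def stopTime {Ω : Type*} (X : ℕ → Ω → ℝ) (t : ℝ) (ω : Ω) : ℕ :=
  sInf {n : ℕ | t ≤ walk X n ω}

/-- The overshoot `S_{n_t} - t`. -/
def overshoot {Ω : Type*} (X : ℕ → Ω → ℝ) (t : ℝ) (ω : Ω) : ℝ :=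
  walk X (stopTime X t ω) ω - t

end StoppedRenewal

end

/-! Write `λ = ∑ p_a δ_a`, `M = |supp λ|`, `ψ(t) = E g(S_{n_t} - t)` for `t > 0` and `ψ = 0`
elsewhere, `T(x) = 1_{x ≥ 0} λ((x, ∞))`, and `G` for the contribution of a single crossing step.
Summing over the index of that step gives `ψ = G * U`, where `U` is the renewal measure. The
intervals `[S_n, S_{n+1})` partition the half-line, so `T * U = 1_{[0, ∞)}` and hence `T * ψ` is the
primitive of `G` (`integral_tailFun_mul_overshootMean`). With `L = σ⁻¹ ∫ G`, which is the claimed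
limit, `H = ψ - L 1_{(0, ∞)}` satisfies `T * H = W` with `W` bounded and supported in `[0, M]`.

This equation is inverted by Fourier analysis. The transform of `T` is `(1 - ℒλ(2πiw)) / (2πiw)`.
The diophantine condition makes it zero-free, with inverse `O(|w|^{1+l})`, and its first three
derivatives cost at most `|w|^{1+8l}`. Multiplying the inverse by the transform of a bump at scale
`δ` gives a kernel `R` with `R * T = φ_δ` and `|R(x)| ≲ δ^{-(2+8l)} (1+|x|)^{-3}` (`exists_kernel`).
Thus `φ_δ * H = R * W` is `O(δ)` near `t` when `δ` is comparable to `t^{-1/(4l+1)}`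
(`exists_mollified_bound`).

The mollification is removed by a Tauberian argument. For `g(x) = x` the mean overshoot is `Z(t) -
t`, where `Z(t) = E S_{n_t}` is monotone, so the mollified estimate yields `Z(t) - Z(t - δ) = O(δ)`.
For general `g`, between times `t - u` and `t` either the same step crosses both levels, and the
overshoot moves by `u`, or the passage position jumps by at least the smallest atom `r`, and
Markov's inequality bounds the probability of this by the increment of `Z` over `r`
(`norm_overshootMean_sub_le`). So `ψ` varies by `O(δ)` over the mollification window. -/

namespace StoppedRenewal

open scoped Real FourierTransform SchwartzMap Topology

/-! ### Families of functions with derivative bounds -/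

/-- The derivatives of order at most `k` of the functions `f i` are bounded by a common multiple
of the weights `ω i`. -/
def DerivBound {ι : Type*} : ℕ → (ι → ℝ → ℝ) → (ι → ℝ → ℂ) → Prop
  | 0, ω, f => ∃ C : ℝ, ∀ i w, ‖f i w‖ ≤ C * ω i w
  | k + 1, ω, f => (∃ C : ℝ, ∀ i w, ‖f i w‖ ≤ C * ω i w) ∧ (∀ i, Differentiable ℝ (f i)) ∧
      DerivBound k ω (fun i => deriv (f i))

namespace DerivBound

variable {ι : Type*} {k : ℕ} {ω η θ : ι → ℝ → ℝ} {f g : ι → ℝ → ℂ}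

lemma bound (h : DerivBound k ω f) : ∃ C : ℝ, ∀ i w, ‖f i w‖ ≤ C * ω i w := by
  cases k with
  | zero => exact h
  | succ k => exact h.1

lemma of_succ (h : DerivBound (k + 1) ω f) : DerivBound k ω f := by
  induction k generalizing f with
  | zero => exact h.1
  | succ k ih => exact ⟨h.1, h.2.1, ih h.2.2⟩

lemma add (hf : DerivBound k ω f) (hg : DerivBound k ω g) :
    DerivBound k ω (fun i w => f i w + g i w) := by
  induction k generalizing f g with
  | zero =>
    obtain ⟨C, hC⟩ := hf
    obtain ⟨D, hD⟩ := hg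
    refine ⟨C + D, fun i w => (norm_add_le _ _).trans ?_⟩
    linarith [hC i w, hD i w]
  | succ k ih =>
    obtain ⟨C, hC⟩ := hf.1
    obtain ⟨D, hD⟩ := hg.1
    refine ⟨⟨C + D, fun i w => (norm_add_le _ _).trans (by linarith [hC i w, hD i w])⟩,
      fun i => (hf.2.1 i).add (hg.2.1 i), ?_⟩
    convert! ih hf.2.2 hg.2.2 using 3 with i w
    exact deriv_fun_add (hf.2.1 i w) (hg.2.1 i w)

lemma mul (hθ : ∀ i w, ω i w * η i w ≤ θ i w) (hω : ∀ i w, 0 ≤ ω i w) (hη : ∀ i w, 0 ≤ η i w)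
    (hf : DerivBound k ω f) (hg : DerivBound k η g) :
    DerivBound k θ (fun i w => f i w * g i w) := by
  have key : ∀ {f g : ι → ℝ → ℂ}, (∃ C : ℝ, ∀ i w, ‖f i w‖ ≤ C * ω i w) →
      (∃ C : ℝ, ∀ i w, ‖g i w‖ ≤ C * η i w) →
      ∃ C : ℝ, ∀ i w, ‖f i w * g i w‖ ≤ C * θ i w := by
    rintro f g ⟨C, hC⟩ ⟨D, hD⟩
    refine ⟨|C| * |D|, fun i w => ?_⟩
    have h1 : ‖f i w‖ ≤ |C| * ω i w :=
      (hC i w).trans (mul_le_mul_of_nonneg_right (le_abs_self C) (hω i w))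
    have h2 : ‖g i w‖ ≤ |D| * η i w :=
      (hD i w).trans (mul_le_mul_of_nonneg_right (le_abs_self D) (hη i w))
    calc ‖f i w * g i w‖ = ‖f i w‖ * ‖g i w‖ := norm_mul _ _
      _ ≤ (|C| * ω i w) * (|D| * η i w) :=
        mul_le_mul h1 h2 (norm_nonneg _) (mul_nonneg (abs_nonneg C) (hω i w))
      _ = |C| * |D| * (ω i w * η i w) := by ring
      _ ≤ |C| * |D| * θ i w := mul_le_mul_of_nonneg_left (hθ i w) (by positivity)
  induction k generalizing f g with
  | zero => exact key hf hg
  | succ k ih =>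
    refine ⟨key hf.1 hg.1, fun i => (hf.2.1 i).mul (hg.2.1 i), ?_⟩
    convert! (ih hf.2.2 hg.of_succ).add (ih hf.of_succ hg.2.2) using 3 with i w
    exact deriv_fun_mul (hf.2.1 i w) (hg.2.1 i w)

lemma const_mul {c : ι → ℂ} {B : ℝ} (hc : ∀ i, ‖c i‖ ≤ B)
    (hf : DerivBound k ω f) : DerivBound k ω (fun i w => c i * f i w) := by
  have key : ∀ {f : ι → ℝ → ℂ}, (∃ C : ℝ, ∀ i w, ‖f i w‖ ≤ C * ω i w) →
      ∃ C : ℝ, ∀ i w, ‖c i * f i w‖ ≤ C * ω i w := by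
    rintro f ⟨C, hC⟩
    refine ⟨B * C, fun i w => ?_⟩
    rw [norm_mul, mul_assoc]
    exact mul_le_mul (hc i) (hC i w) (norm_nonneg _) ((norm_nonneg _).trans (hc i))
  induction k generalizing f with
  | zero => exact key hf
  | succ k ih =>
    refine ⟨key hf.1, fun i => (hf.2.1 i).const_mul (c i), ?_⟩
    convert! ih hf.2.2 using 3 with i w
    exact deriv_const_mul (c i) (hf.2.1 i w)

lemma finset_sum {α : Type*} (s : Finset α) {f : α → ι → ℝ → ℂ}
    (hf : ∀ a ∈ s, DerivBound k ω (f a)) (hω : ∀ i w, 0 ≤ ω i w) :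
    DerivBound k ω (fun i w => ∑ a ∈ s, f a i w) := by
  classical
  have zero : ∀ k, DerivBound k ω (fun (_ : ι) (_ : ℝ) => (0 : ℂ)) := by
    intro k
    induction k with
    | zero => exact ⟨1, fun i w => by simpa using hω i w⟩
    | succ k ih =>
      refine ⟨⟨1, fun i w => by simpa using hω i w⟩, fun i => differentiable_const _, ?_⟩
      simpa using ih
  induction s using Finset.induction_on with
  | empty => simpa using zero k
  | insert a s ha ih =>
    simp only [Finset.sum_insert ha]
    exact (hf a (Finset.mem_insert_self a s)).add
      (ih fun b hb => hf b (Finset.mem_insert_of_mem hb))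

lemma mono (h : ∀ i w, ω i w ≤ η i w) (hω : ∀ i w, 0 ≤ ω i w) (hf : DerivBound k ω f) :
    DerivBound k η f := by
  have key : ∀ {f : ι → ℝ → ℂ}, (∃ C : ℝ, ∀ i w, ‖f i w‖ ≤ C * ω i w) →
      ∃ C : ℝ, ∀ i w, ‖f i w‖ ≤ C * η i w := by
    rintro f ⟨C, hC⟩
    refine ⟨|C|, fun i w => (hC i w).trans ?_⟩
    exact (mul_le_mul_of_nonneg_right (le_abs_self C) (hω i w)).trans
      (mul_le_mul_of_nonneg_left (h i w) (abs_nonneg C))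
  induction k generalizing f with
  | zero => exact key hf
  | succ k ih => exact ⟨key hf.1, hf.2.1, ih hf.2.2⟩

/-- A function which stays bounded, with its derivatives, after multiplication by the variable
gains one order of decay. -/
lemma of_id_mul (hf : DerivBound k (fun _ _ => 1) f)
    (hwf : DerivBound k (fun _ _ => 1) (fun i w => (w : ℂ) * f i w)) :
    DerivBound k (fun _ w => (1 + |w|)⁻¹) f := by
  have key : ∀ {f : ι → ℝ → ℂ}, (∃ C : ℝ, ∀ i w, ‖f i w‖ ≤ C * 1) →
      (∃ C : ℝ, ∀ i (w : ℝ), ‖(w : ℂ) * f i w‖ ≤ C * 1) →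
      ∃ C : ℝ, ∀ i w, ‖f i w‖ ≤ C * (1 + |w|)⁻¹ := by
    rintro f ⟨C, hC⟩ ⟨D, hD⟩
    refine ⟨C + D, fun i w => ?_⟩
    rw [← div_eq_mul_inv, le_div_iff₀ (by positivity)]
    have h1 := hC i w
    have h2 := hD i w
    rw [norm_mul, Complex.norm_real, Real.norm_eq_abs] at h2
    nlinarith
  induction k generalizing f with
  | zero => exact key hf hwf
  | succ k ih =>
    refine ⟨key hf.1 hwf.1, hf.2.1, ih hf.2.2 ?_⟩
    -- The product rule gives `w f' = (w f)' - f`, so the hypothesis passes to the derivative.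
    have h := hwf.2.2.add (hf.of_succ.const_mul (c := fun _ => -1)
      (B := 1) (fun _ => by simp))
    convert! h using 3 with i w
    have hd : HasDerivAt (fun w : ℝ => (w : ℂ) * f i w) (1 * f i w + w * deriv (f i) w) w :=
      (Complex.ofRealCLM.hasDerivAt (x := w)).mul (hf.2.1 i w).hasDerivAt
    rw [hd.deriv]
    ring

lemma exp_mul (c : ι → ℝ) {B : ℝ} (hc : ∀ i, |c i| ≤ B) :
    DerivBound k (fun _ _ => 1) (fun i w => Complex.exp (-(Complex.I * (c i : ℂ) * (w : ℂ)))) := by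
  have hb : ∃ C : ℝ, ∀ i (w : ℝ), ‖Complex.exp (-(Complex.I * (c i : ℂ) * (w : ℂ)))‖ ≤ C * 1 := by
    refine ⟨1, fun i w => ?_⟩
    rw [Complex.norm_exp]
    simp
  induction k with
  | zero => exact hb
  | succ k ih =>
    have hd : ∀ i (w : ℝ), HasDerivAt (fun w : ℝ => Complex.exp (-(Complex.I * (c i : ℂ) * (w : ℂ))))
        (-(Complex.I * (c i : ℂ)) * Complex.exp (-(Complex.I * (c i : ℂ) * (w : ℂ)))) w := by
      intro i w
      have h1 : HasDerivAt (fun w : ℝ => -(Complex.I * (c i : ℂ) * (w : ℂ)))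
          (-(Complex.I * (c i : ℂ) * 1)) w :=
        ((Complex.ofRealCLM.hasDerivAt (x := w)).const_mul _).neg
      convert! h1.cexp using 1
      ring
    refine ⟨hb, fun i w => (hd i w).differentiableAt, ?_⟩
    convert! ih.const_mul (c := fun i => -(Complex.I * (c i : ℂ))) (B := B)
      (fun i => by simpa using hc i) using 3 with i w
    exact (hd i w).deriv

/-- The Fourier transforms of a function all of whose moments are integrable. -/
lemma fourier {u : ι → ℝ → ℂ} [Finite ι]
    (hu : ∀ i (n : ℕ), Integrable (fun x : ℝ => (x : ℂ) ^ n * u i x)) :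
    DerivBound k (fun _ _ => 1) (fun i => 𝓕 (u i)) := by
  have hb : ∀ {u : ι → ℝ → ℂ}, ∃ C : ℝ, ∀ i w, ‖𝓕 (u i) w‖ ≤ C * 1 := by
    intro u
    obtain ⟨C, hC⟩ := (Set.finite_range fun i => ∫ x, ‖u i x‖).bddAbove
    refine ⟨C, fun i w => ?_⟩
    rw [mul_one]
    exact (VectorFourier.norm_fourierIntegral_le_integral_norm _ _ _ _ _).trans (hC ⟨i, rfl⟩)
  induction k generalizing u with
  | zero => exact hb
  | succ k ih =>
    have h0 : ∀ i, Integrable (u i) := fun i => by simpa using hu i 0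
    have h1 : ∀ i, Integrable (fun x : ℝ => x • u i x) := fun i => by simpa using hu i 1
    refine ⟨hb, fun i w => (Real.hasDerivAt_fourier (h0 i) (h1 i) w).differentiableAt, ?_⟩
    simp only [fun i => Real.deriv_fourier (h0 i) (h1 i)]
    refine ih fun i n => ?_
    convert! (hu i (n + 1)).const_mul (-2 * π * Complex.I) using 2 with x
    simp only [smul_eq_mul]
    ring

lemma congr_fun (hf : DerivBound k ω f) (h : ∀ i w, g i w = f i w) : DerivBound k ω g := by
  have : g = f := funext fun i => funext (h i)
  rwa [this]

/-- Derivative bounds for the inverse of a function whose derivatives decay. -/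
lemma inv_of_bound {m : ι → ℝ → ℂ} {e : ℝ} (he : 0 ≤ e) (hm0 : ∀ i w, m i w ≠ 0)
    (hm : DerivBound (k + 1) (fun _ w => (1 + |w|)⁻¹) m)
    (h : DerivBound k (fun _ w => (1 + |w|) ^ (1 + e)) (fun i w => (m i w)⁻¹)) :
    DerivBound (k + 1) (fun _ w => (1 + |w|) ^ (1 + 2 * e)) (fun i w => (m i w)⁻¹) := by
  have hle : ∀ w : ℝ, (1 + |w|) ^ (1 + e) ≤ (1 + |w|) ^ (1 + 2 * e) := fun w =>
    Real.rpow_le_rpow_of_exponent_le (by linarith [abs_nonneg w]) (by linarith)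
  have hd : ∀ i w, HasDerivAt (fun w => (m i w)⁻¹) (-deriv (m i) w / m i w ^ 2) w := fun i w =>
    ((hm.2.1 i w).hasDerivAt.fun_inv (hm0 i w))
  refine ⟨?_, fun i w => (hd i w).differentiableAt, ?_⟩
  · exact (h.mono (fun _ w => hle w) (fun _ w => by positivity)).bound
  -- `(1/m)' = -m' (1/m)²`: the two inverses contribute `2 + 2e` and the decay of `m'` removes `1`.
  -- Each differentiation therefore doubles the excess exponent `e`.
  · have h2 := DerivBound.mul (θ := fun _ w => (1 + |w|) ^ (2 + 2 * e)) (fun i w => le_of_eq (by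
      rw [← Real.rpow_add (by positivity)]; congr 1; ring)) (fun _ w => by positivity)
      (fun _ w => by positivity) h h
    have h3 := DerivBound.mul (θ := fun _ w => (1 + |w|) ^ (1 + 2 * e)) (fun i w => le_of_eq (by
      rw [show (1 + |w|)⁻¹ = (1 + |w|) ^ (-1 : ℝ) from (Real.rpow_neg_one _).symm,
        ← Real.rpow_add (by positivity)]; congr 1; ring)) (fun _ w => by positivity)
      (fun _ w => by positivity) hm.2.2 h2
    refine (h3.const_mul (c := fun _ => -1) (B := 1)
      (fun _ => by simp)).congr_fun fun i w => ?_
    rw [(hd i w).deriv]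
    have := hm0 i w
    field_simp

lemma comp {κ : Type*} (σ : κ → ι) (h : DerivBound k ω f) :
    DerivBound k (fun j => ω (σ j)) (fun j => f (σ j)) := by
  induction k generalizing f with
  | zero =>
    obtain ⟨C, hC⟩ := h
    exact ⟨C, fun j => hC (σ j)⟩
  | succ k ih =>
    obtain ⟨C, hC⟩ := h.1
    exact ⟨⟨C, fun j => hC (σ j)⟩, fun j => h.2.1 (σ j), ih h.2.2⟩

lemma integrable (h : DerivBound k ω f) (hf : ∀ i, AEStronglyMeasurable (f i))
    (hω : ∀ i, Integrable (ω i)) (i : ι) : Integrable (f i) := by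
  obtain ⟨C, hC⟩ := h.bound
  exact ((hω i).const_mul C).mono' (hf i) (Eventually.of_forall (hC i))

/-- Each derivative becomes a factor `2πix` on the Fourier side. The constant is uniform over the
family; the member enters only through the integral of its weight. -/
lemma norm_fourier_le (h : DerivBound k ω f) (hf : ∀ i, AEStronglyMeasurable (f i))
    (hω : ∀ i, Integrable (ω i)) :
    ∃ C : ℝ, ∀ i x, (2 * π * |x|) ^ k * ‖𝓕 (f i) x‖ ≤ C * ∫ w, ω i w := by
  induction k generalizing f with
  | zero =>
    obtain ⟨C, hC⟩ := h
    refine ⟨C, fun i x => ?_⟩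
    rw [pow_zero, one_mul, Real.fourier_real_eq, ← integral_const_mul]
    exact norm_integral_le_of_norm_le ((hω i).const_mul C)
      (Eventually.of_forall fun w => by simpa using hC i w)
  | succ k ih =>
    obtain ⟨C, hC⟩ := ih h.2.2 (fun i => (measurable_deriv (f i)).aestronglyMeasurable)
    refine ⟨C, fun i x => le_trans (le_of_eq ?_) (hC i x)⟩
    rw [Real.fourier_deriv (h.integrable hf hω i) (h.2.1 i)
      (h.2.2.integrable (fun i => (measurable_deriv (f i)).aestronglyMeasurable) hω i)]
    rw [norm_smul]
    simp only [norm_mul, Complex.norm_ofNat, Complex.norm_real, Complex.norm_I, Real.norm_eq_abs,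
      abs_of_pos Real.pi_pos]
    ring

end DerivBound

/-! ### Approximate convolution inverses -/

lemma schwartz_bound (Φ : 𝓢(ℝ, ℂ)) (N : ℝ) :
    ∃ C : ℝ, ∀ x, ‖Φ x‖ ≤ C * (1 + |x|) ^ (-N) := by
  obtain ⟨n, hn⟩ := exists_nat_ge N
  refine ⟨2 ^ n * ((Finset.Iic (n, 0)).sup fun m => SchwartzMap.seminorm ℝ m.1 m.2) Φ,
    fun x => ?_⟩
  have h := SchwartzMap.one_add_le_sup_seminorm_apply (𝕜 := ℝ) (m := (n, 0)) (k := n) (n := 0)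
    le_rfl le_rfl Φ x
  rw [norm_iteratedFDeriv_zero, Real.norm_eq_abs] at h
  have h1 : (1 + |x|) ^ N * ‖Φ x‖ ≤ (1 + |x|) ^ n * ‖Φ x‖ := by
    gcongr
    rw [← Real.rpow_natCast]
    exact Real.rpow_le_rpow_of_exponent_le (by linarith [abs_nonneg x]) hn
  rw [Real.rpow_neg (by positivity), ← div_eq_mul_inv, le_div_iff₀ (by positivity), mul_comm]
  exact h1.trans h

/-- Every differentiation produces a factor `δ ≤ 1`, so the bounds are uniform in the scale. -/
lemma derivBound_dilation (Φ : 𝓢(ℝ, ℂ)) (N : ℝ) (k : ℕ) :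
    DerivBound k (fun (δ : Ioc (0 : ℝ) 1) w => (1 + |(δ : ℝ) * w|) ^ (-N))
      (fun δ w => Φ ((δ : ℝ) * w)) := by
  have hb : ∀ Φ : 𝓢(ℝ, ℂ), ∃ C : ℝ, ∀ (δ : Ioc (0 : ℝ) 1) (w : ℝ),
      ‖Φ ((δ : ℝ) * w)‖ ≤ C * (1 + |(δ : ℝ) * w|) ^ (-N) := by
    intro Φ
    obtain ⟨C, hC⟩ := schwartz_bound Φ N
    exact ⟨C, fun δ w => hC _⟩
  induction k generalizing Φ with
  | zero => exact hb Φ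
  | succ k ih =>
    have hd : ∀ (δ : Ioc (0 : ℝ) 1) (w : ℝ), HasDerivAt (fun w => Φ ((δ : ℝ) * w))
        (((δ : ℝ) : ℂ) * (SchwartzMap.derivCLM ℝ ℂ Φ) ((δ : ℝ) * w)) w := by
      intro δ w
      have h1 : HasDerivAt Φ (deriv Φ ((δ : ℝ) * w)) ((δ : ℝ) * w) :=
        Φ.differentiable.differentiableAt.hasDerivAt
      have h2 : HasDerivAt (fun w => (δ : ℝ) * w) (δ : ℝ) w := by
        simpa using (hasDerivAt_id w).const_mul (δ : ℝ)
      convert! h1.scomp w h2 using 1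
    refine ⟨hb Φ, fun δ w => (hd δ w).differentiableAt, ?_⟩
    refine ((ih (SchwartzMap.derivCLM ℝ ℂ Φ)).const_mul (c := fun δ : Ioc (0 : ℝ) 1 => ((δ : ℝ) : ℂ)) (B := 1)
      fun δ => ?_).congr_fun fun δ w => (hd δ w).deriv
    rw [Complex.norm_real, Real.norm_eq_abs, abs_of_pos δ.2.1]
    exact δ.2.2

lemma integral_dilated_weight {δ : ℝ} (hδ : 0 < δ) (e : ℝ) :
    Integrable (fun w : ℝ => δ ^ (-e) * (1 + |δ * w|) ^ (-2 : ℝ)) ∧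
    ∫ w : ℝ, δ ^ (-e) * (1 + |δ * w|) ^ (-2 : ℝ) =
      δ ^ (-(e + 1)) * ∫ w : ℝ, (1 + |w|) ^ (-2 : ℝ) := by
  have h : Integrable (fun w : ℝ => (1 + |w|) ^ (-2 : ℝ)) :=
    integrable_one_add_norm (E := ℝ) (by norm_num)
  refine ⟨(h.comp_mul_left' hδ.ne').const_mul _, ?_⟩
  rw [integral_const_mul, Measure.integral_comp_mul_left (fun w : ℝ => (1 + |w|) ^ (-2 : ℝ)) δ,
    abs_of_pos (inv_pos.2 hδ), smul_eq_mul, ← mul_assoc]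
  congr 1
  rw [← Real.rpow_neg_one, ← Real.rpow_add hδ]
  congr 1
  ring

/-- Inverse Fourier transform of a product with a Fourier transform. -/
lemma integral_convolution_eq {F T : ℝ → ℂ} (hF : Integrable F) (hT : Integrable T) (x : ℝ) :
    ∫ y, 𝓕 F (-(x - y)) * T y = 𝓕 (fun w => F w * 𝓕 T w) (-x) := by
  simp only [Real.fourier_real_eq_integral_exp_smul, smul_eq_mul]
  simp only [← integral_mul_const, ← integral_const_mul]
  rw [integral_integral_swap]
  · congr 1 with w
    congr 1 with y
    rw [show Complex.exp (↑(-2 * π * w * -x) * Complex.I) * (F w *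
      (Complex.exp (↑(-2 * π * y * w) * Complex.I) * T y)) =
      (Complex.exp (↑(-2 * π * w * -x) * Complex.I) * Complex.exp (↑(-2 * π * y * w) * Complex.I))
        * F w * T y by ring, ← Complex.exp_add]
    congr 3
    push_cast
    ring
  · have h := hT.mul_prod hF
    refine (h.bdd_mul (f := fun z : ℝ × ℝ =>
      Complex.exp (↑(-2 * π * z.2 * -(x - z.1)) * Complex.I)) (c := 1) ?_ ?_).congr ?_
    · exact (by fun_prop : Continuous _).aestronglyMeasurable
    · exact Eventually.of_forall fun z => by rw [Complex.norm_exp_ofReal_mul_I]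
    · refine Eventually.of_forall fun z => ?_
      simp only [Function.uncurry]
      ring

lemma fourier_dilation (φ : 𝓢(ℝ, ℂ)) {δ : ℝ} (hδ : 0 < δ) (x : ℝ) :
    𝓕 (fun w => (𝓕 φ : 𝓢(ℝ, ℂ)) (δ * w)) (-x) = (δ : ℂ)⁻¹ * φ (x / δ) := by
  have h1 : φ (x / δ) = 𝓕 ((𝓕 φ : 𝓢(ℝ, ℂ)) : ℝ → ℂ) (-(x / δ)) := by
    rw [← Real.fourierInv_eq_fourier_neg, ← SchwartzMap.fourierInv_coe,
      FourierTransform.fourierInv_fourier_eq]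
  rw [h1, Real.fourier_real_eq_integral_exp_smul, Real.fourier_real_eq_integral_exp_smul]
  have h2 := Measure.integral_comp_mul_left (fun v : ℝ =>
    Complex.exp (↑(-2 * π * v * -(x / δ)) * Complex.I) • (𝓕 φ : 𝓢(ℝ, ℂ)) v) δ
  rw [abs_of_pos (inv_pos.2 hδ)] at h2
  rw [← Complex.ofReal_inv, ← Complex.real_smul, ← h2]
  congr 1 with v
  rw [show -2 * π * v * -x = -2 * π * (δ * v) * -(x / δ) by field_simp]

/-- A kernel inverting the convolution by `T` up to a mollification at scale `δ`. -/
theorem exists_kernel (φ : 𝓢(ℝ, ℂ)) {T : ℝ → ℂ} (hT : Integrable T) {e : ℝ} (he : 0 ≤ e)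
    (hT0 : ∀ w, 𝓕 T w ≠ 0)
    (hinv : DerivBound 3 (fun (_ : Unit) w => (1 + |w|) ^ e) (fun _ w => (𝓕 T w)⁻¹)) :
    ∃ C : ℝ, 0 ≤ C ∧ ∀ δ : ℝ, 0 < δ → δ ≤ 1 → ∃ R : ℝ → ℂ, Continuous R ∧
      (∀ x, ‖R x‖ * (1 + |x|) ^ 3 ≤ C * δ ^ (-(e + 1))) ∧
      ∀ x, ∫ y, R (x - y) * T y = (δ : ℂ)⁻¹ * φ (x / δ) := by
  set Φ : 𝓢(ℝ, ℂ) := 𝓕 φ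
  set F : Ioc (0 : ℝ) 1 → ℝ → ℂ := fun δ w => Φ ((δ : ℝ) * w) * (𝓕 T w)⁻¹ with hFdef
  set θ : Ioc (0 : ℝ) 1 → ℝ → ℝ := fun δ w => (δ : ℝ) ^ (-e) * (1 + |(δ : ℝ) * w|) ^ (-2 : ℝ)
  -- The Schwartz decay is used with exponent `e + 2`: the part `e` absorbs the growth of the
  -- inverse at the cost of `δ ^ (-e)`, since `1 + |w| ≤ δ⁻¹ (1 + |δ w|)`, and the part `2` leaves
  -- an integrable weight, whose integral costs one more `δ⁻¹`.
  have hF : DerivBound 3 θ F := by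
    refine DerivBound.mul (fun δ w => ?_) (fun δ w => by positivity) (fun δ w => by positivity)
      (derivBound_dilation Φ (e + 2) 3) (hinv.comp (fun _ => ()))
    have hδ := δ.2.1
    have h1 : 1 + |w| ≤ (δ : ℝ)⁻¹ * (1 + |(δ : ℝ) * w|) := by
      rw [inv_mul_eq_div, le_div_iff₀ hδ, abs_mul, abs_of_pos hδ]
      nlinarith [δ.2.2, abs_nonneg w]
    have h2 : (1 + |w|) ^ e ≤ (δ : ℝ) ^ (-e) * (1 + |(δ : ℝ) * w|) ^ e := by
      rw [Real.rpow_neg hδ.le, ← Real.inv_rpow hδ.le, ← Real.mul_rpow (by positivity)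
        (by positivity)]
      exact Real.rpow_le_rpow (by positivity) h1 he
    calc (1 + |(δ : ℝ) * w|) ^ (-(e + 2)) * (1 + |w|) ^ e
        ≤ (1 + |(δ : ℝ) * w|) ^ (-(e + 2)) * ((δ : ℝ) ^ (-e) * (1 + |(δ : ℝ) * w|) ^ e) := by
          gcongr
      _ = (δ : ℝ) ^ (-e) * ((1 + |(δ : ℝ) * w|) ^ (-(e + 2)) * (1 + |(δ : ℝ) * w|) ^ e) := by ring
      _ = θ δ w := by
          rw [← Real.rpow_add (by positivity)]
          congr 2
          ring
  have hθ : ∀ δ, Integrable (θ δ) := fun δ => (integral_dilated_weight δ.2.1 e).1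
  have hmeas : ∀ δ, AEStronglyMeasurable (F δ) := fun δ =>
    (hF.2.1 δ).continuous.aestronglyMeasurable
  -- Order `0` controls the kernel near the origin, order `3` controls its tail.
  obtain ⟨C₀, hC₀⟩ := (hF.of_succ.of_succ.of_succ).norm_fourier_le hmeas hθ
  obtain ⟨C₃, hC₃⟩ := hF.norm_fourier_le hmeas hθ
  set J := ∫ w : ℝ, (1 + |w|) ^ (-2 : ℝ)
  have hJ : 0 ≤ J := integral_nonneg fun w => by positivity
  have hFint : ∀ δ, Integrable (F δ) := hF.integrable hmeas hθ
  refine ⟨8 * (|C₀| + |C₃|) * J, by positivity, fun δ hδ hδ1 =>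
    ⟨fun x => 𝓕 (F ⟨δ, hδ, hδ1⟩) (-x), ?_, fun x => ?_, fun x => ?_⟩⟩
  · have : Continuous (𝓕 (F ⟨δ, hδ, hδ1⟩)) :=
      VectorFourier.fourierIntegral_continuous Real.continuous_fourierChar
        (by exact continuous_inner) (hFint _)
    exact this.comp continuous_neg
  · have h0 := hC₀ ⟨δ, hδ, hδ1⟩ (-x)
    have h3 := hC₃ ⟨δ, hδ, hδ1⟩ (-x)
    simp only [θ] at h0 h3
    rw [(integral_dilated_weight hδ e).2] at h0 h3
    rw [abs_neg] at h0 h3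
    set Q := ‖𝓕 (F ⟨δ, hδ, hδ1⟩) (-x)‖
    have hQ : 0 ≤ Q := norm_nonneg _
    set D := δ ^ (-(e + 1)) * J
    have hD : 0 ≤ D := by positivity
    have h3' : |x| ^ 3 * Q ≤ |C₃| * D := by
      have : |x| ^ 3 * Q ≤ (2 * π * |x|) ^ 3 * Q := by
        gcongr
        nlinarith [Real.pi_gt_three, abs_nonneg x]
      exact this.trans (h3.trans (mul_le_mul_of_nonneg_right (le_abs_self _) hD))
    have h0' : Q ≤ |C₀| * D := by
      rw [pow_zero, one_mul] at h0
      exact h0.trans (mul_le_mul_of_nonneg_right (le_abs_self _) hD)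
    have hx : (1 + |x|) ^ 3 ≤ 8 * (1 + |x| ^ 3) := by
      have := abs_nonneg x
      nlinarith [mul_nonneg this (sq_nonneg (|x| - 1)), sq_nonneg (|x| - 1)]
    calc Q * (1 + |x|) ^ 3 ≤ Q * (8 * (1 + |x| ^ 3)) := by gcongr
      _ = 8 * (Q + |x| ^ 3 * Q) := by ring
      _ ≤ 8 * (|C₀| * D + |C₃| * D) := by gcongr
      _ = _ := by ring
  · rw [integral_convolution_eq (hFint _) hT, ← fourier_dilation φ hδ]
    refine congr_arg (fun f : ℝ → ℂ => 𝓕 f (-x)) (funext fun w => ?_)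
    simp only [F, inv_mul_cancel_right₀ (hT0 w), Φ]

/-- A bounded function whose convolution with `T` is known can be recovered, up to a mollification,
from an approximate convolution inverse of `T`. -/
lemma integral_kernel_mul {R T H W φ : ℝ → ℂ} {A : ℝ} (hR : Integrable R) (hT : Integrable T)
    (hH : Measurable H) (hHA : ∀ x, ‖H x‖ ≤ A)
    (hW : ∀ s, ∫ y, T y * H (s - y) = W s)
    (hφ : ∀ x, ∫ y, R (x - y) * T y = φ x) (t : ℝ) :
    ∫ u, φ u * H (t - u) = ∫ v, R v * W (t - v) := by
  have hbase : Integrable (fun z : ℝ × ℝ => R z.1 * T z.2) (volume.prod volume) := hR.mul_prod hT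
  have hint1 : Integrable (fun z : ℝ × ℝ => R z.1 * (T z.2 * H (t - z.1 - z.2)))
      (volume.prod volume) := by
    refine (hbase.mul_bdd (c := A) (g := fun z : ℝ × ℝ => H (t - z.1 - z.2)) ?_
      (Eventually.of_forall fun z => hHA _)).congr (Eventually.of_forall fun z => by simp [mul_assoc])
    exact (hH.comp (by fun_prop)).aestronglyMeasurable
  -- The shear `(u, y) ↦ (u - y, y)` preserves Lebesgue measure and carries this integrand to the
  -- previous one.
  have hshear : Integrable (fun z : ℝ × ℝ => R (z.1 - z.2) * (T z.2 * H (t - z.1)))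
      (volume.prod volume) := by
    have := (measurePreserving_sub_prod (volume : Measure ℝ) (volume : Measure ℝ))
    have h2 := this.integrable_comp_of_integrable hint1
    refine h2.congr (Eventually.of_forall fun z => ?_)
    simp only [Function.comp_apply, sub_sub, sub_add_cancel]
  calc ∫ u, φ u * H (t - u) = ∫ u, ∫ y, R (u - y) * (T y * H (t - u)) := by
        congr 1 with u
        rw [← hφ, ← integral_mul_const]
        simp only [mul_assoc]
    _ = ∫ y, ∫ u, R (u - y) * (T y * H (t - u)) := integral_integral_swap hshear
    _ = ∫ y, ∫ v, R v * (T y * H (t - v - y)) := by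
        congr 1 with y
        rw [← integral_add_right_eq_self _ y]
        congr 1 with v
        rw [add_sub_cancel_right, sub_sub]
    _ = ∫ v, ∫ y, R v * (T y * H (t - v - y)) := (integral_integral_swap hint1).symm
    _ = ∫ v, R v * W (t - v) := by
        congr 1 with v
        rw [integral_const_mul, hW]

/-! ### Fourier transform of the tail function -/

/-- The function `x ↦ 1_{x ≥ 0} λ((x, ∞))` for `λ = ∑ a ∈ S, p a δ_a`. -/
noncomputable def tailFun (S : Finset ℝ) (p : ℝ → ℝ) (x : ℝ) : ℂ :=
  ∑ a ∈ S, (p a : ℂ) * (Ico 0 a).indicator (fun _ => (1 : ℂ)) x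

/-- The values `ℒλ(ib)` for `λ = ∑ a ∈ S, p a δ_a`. -/
noncomputable def expSum (S : Finset ℝ) (p : ℝ → ℝ) (b : ℝ) : ℂ :=
  ∑ a ∈ S, (p a : ℂ) * Complex.exp (-(Complex.I * b * a))

section

variable {S : Finset ℝ} {p : ℝ → ℝ}

lemma integrable_indicator_Ico_mul {f : ℝ → ℂ} (hf : Continuous f) (a : ℝ) :
    Integrable (fun x => f x * (Ico 0 a).indicator (fun _ => (1 : ℂ)) x) := by
  have h : IntegrableOn f (Ico 0 a) :=
    (hf.continuousOn.integrableOn_Icc (a := 0) (b := a)).mono_set Ico_subset_Icc_self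
  rw [← integrable_indicator_iff measurableSet_Ico] at h
  refine h.congr (Eventually.of_forall fun x => ?_)
  by_cases hx : x ∈ Ico 0 a <;> simp [hx]

lemma integral_indicator_Ico_mul {f : ℝ → ℂ} {a : ℝ} (ha : 0 ≤ a) :
    ∫ x, f x * (Ico 0 a).indicator (fun _ => (1 : ℂ)) x = ∫ x in (0 : ℝ)..a, f x := by
  rw [intervalIntegral.integral_of_le ha, integral_Ioc_eq_integral_Ioo,
    ← integral_Ico_eq_integral_Ioo, ← integral_indicator measurableSet_Ico]
  congr 1 with x
  by_cases hx : x ∈ Ico 0 a <;> simp [hx]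

lemma integrable_mul_tailFun {f : ℝ → ℂ} (hf : Continuous f) :
    Integrable (fun x => f x * tailFun S p x) := by
  simp only [tailFun, Finset.mul_sum]
  refine integrable_finsetSum _ fun a _ => ?_
  refine ((integrable_indicator_Ico_mul hf a).const_mul (p a : ℂ)).congr
    (Eventually.of_forall fun x => ?_)
  simp only
  ring

lemma integral_mul_tailFun (hS : ∀ a ∈ S, 0 < a) {f : ℝ → ℂ} (hf : Continuous f) :
    ∫ x, f x * tailFun S p x = ∑ a ∈ S, (p a : ℂ) * ∫ x in (0 : ℝ)..a, f x := by
  simp only [tailFun, Finset.mul_sum]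
  rw [integral_finsetSum]
  · refine Finset.sum_congr rfl fun a ha => ?_
    rw [← integral_indicator_Ico_mul (hS a ha).le, ← integral_const_mul]
    congr 1 with x
    ring
  · intro a _
    refine ((integrable_indicator_Ico_mul hf a).const_mul (p a : ℂ)).congr
      (Eventually.of_forall fun x => ?_)
    simp only
    ring

lemma integrable_tailFun : Integrable (tailFun S p) := by
  simpa using integrable_mul_tailFun (S := S) (p := p) (f := fun _ => 1) continuous_const

lemma fourier_tailFun (hS : ∀ a ∈ S, 0 < a) (w : ℝ) :
    𝓕 (tailFun S p) w =
      ∑ a ∈ S, (p a : ℂ) * ∫ x in (0 : ℝ)..a, Complex.exp (-(2 * π * Complex.I * w) * x) := by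
  rw [Real.fourier_real_eq_integral_exp_smul, ← integral_mul_tailFun hS (by fun_prop)]
  congr 1 with x
  rw [smul_eq_mul]
  congr 2
  push_cast
  ring

/-- The distributional derivative of the tail function is `δ_0 - λ`. Here this is checked atom by
atom by integrating the exponential; `w = 0` is separate because of the division. -/
lemma mul_fourier_tailFun (hS : ∀ a ∈ S, 0 < a) (hsum : ∑ a ∈ S, p a = 1) (w : ℝ) :
    (2 * π * Complex.I * w) * 𝓕 (tailFun S p) w = 1 - expSum S p (2 * π * w) := by
  have h1 : (1 : ℂ) = ∑ a ∈ S, (p a : ℂ) := by rw [← Complex.ofReal_sum, hsum]; simp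
  rw [fourier_tailFun hS, expSum, h1, ← Finset.sum_sub_distrib, Finset.mul_sum]
  refine Finset.sum_congr rfl fun a _ => ?_
  rcases eq_or_ne w 0 with rfl | hw
  · simp
  · have hc : -(2 * π * Complex.I * w) ≠ 0 := by
      have : (w : ℂ) ≠ 0 := by exact_mod_cast hw
      simp [Real.pi_ne_zero, hw]
    rw [integral_exp_mul_complex hc]
    have : Complex.exp (-(Complex.I * ((2 * π * w : ℝ) : ℂ) * a)) =
        Complex.exp (-(2 * π * Complex.I * w) * a) := by
      congr 1
      push_cast
      ring
    rw [this]
    simp only [Complex.ofReal_zero, mul_zero, Complex.exp_zero]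
    generalize Complex.exp (-(2 * π * Complex.I * w) * a) = E
    rw [neg_ne_zero] at hc
    generalize (2 * π * Complex.I * w : ℂ) = z at hc
    field_simp
    ring

lemma fourier_tailFun_zero (hS : ∀ a ∈ S, 0 < a) :
    𝓕 (tailFun S p) 0 = ((∑ a ∈ S, p a * a : ℝ) : ℂ) := by
  rw [fourier_tailFun hS]
  simp

/-- All moments of the tail function are integrable, so all derivatives of its transform are
bounded; `w` times the transform is a trigonometric polynomial, with the same property. `of_id_mul`
then supplies the decay. -/
lemma derivBound_fourier_tailFun (hS : ∀ a ∈ S, 0 < a) (hsum : ∑ a ∈ S, p a = 1) (k : ℕ) :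
    DerivBound k (fun (_ : Unit) w => (1 + |w|)⁻¹) (fun _ => 𝓕 (tailFun S p)) := by
  refine DerivBound.of_id_mul ?_ ?_
  · exact DerivBound.fourier (u := fun _ => tailFun S p)
      fun _ n => integrable_mul_tailFun (by fun_prop)
  · have hexp : ∀ a ∈ S, DerivBound k (fun (_ : Unit) (_ : ℝ) => (1 : ℝ))
        (fun _ w => ((2 * π * Complex.I)⁻¹ * p a) +
          (-(2 * π * Complex.I)⁻¹ * p a) *
            Complex.exp (-(Complex.I * ((2 * π * a : ℝ) : ℂ) * (w : ℂ)))) := by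
      intro a _
      refine DerivBound.add ?_ (DerivBound.const_mul (c := fun _ => _) (fun _ => le_rfl)
        (DerivBound.exp_mul (fun _ => 2 * π * a) fun _ => le_rfl))
      have := DerivBound.const_mul (k := k) (c := fun _ => (2 * π * Complex.I)⁻¹ * (p a : ℂ))
        (fun _ => le_rfl) (DerivBound.exp_mul (fun (_ : Unit) => 0) fun _ => le_rfl)
      simpa using this
    refine (DerivBound.finset_sum S hexp (fun _ _ => zero_le_one)).congr_fun fun _ w => ?_
    have h := mul_fourier_tailFun hS hsum w
    have h1 : (1 : ℂ) = ∑ a ∈ S, (p a : ℂ) := by rw [← Complex.ofReal_sum, hsum]; simp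
    have hpi : (2 * π * Complex.I : ℂ) ≠ 0 := by simp [Real.pi_ne_zero]
    have h2 : (w : ℂ) * 𝓕 (tailFun S p) w =
        (2 * π * Complex.I)⁻¹ * (1 - expSum S p (2 * π * w)) := by
      rw [← h]
      field_simp
    rw [h2, h1, expSum, ← Finset.sum_sub_distrib, Finset.mul_sum]
    refine Finset.sum_congr rfl fun a _ => ?_
    rw [show -(Complex.I * ((2 * π * a : ℝ) : ℂ) * (w : ℂ)) =
      -(Complex.I * ((2 * π * w : ℝ) : ℂ) * a) by push_cast; ring]
    ring

/-- If `ℒλ(ib) = 1` then `ℒλ(inb) = 1` for every `n`. -/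
lemma expSum_nat_mul (hp : ∀ a ∈ S, 0 ≤ p a) (hsum : ∑ a ∈ S, p a = 1) {b : ℝ}
    (hb : expSum S p b = 1) (n : ℕ) : expSum S p (n * b) = 1 := by
  have h1 : ∑ a ∈ S, p a * Real.cos (b * a) = 1 := by
    have := congr_arg Complex.re hb
    rw [expSum, Complex.re_sum] at this
    rw [← Complex.one_re, ← this]
    refine Finset.sum_congr rfl fun a _ => ?_
    rw [Complex.re_ofReal_mul, Complex.exp_re]
    simp
  -- A vanishing sum of nonnegative terms forces `exp(-iba) = 1` at every atom of positive weight, a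
  -- condition stable under integer multiples of `b`.
  have h2 : ∑ a ∈ S, p a * (1 - Real.cos (b * a)) = 0 := by
    simp only [mul_sub, mul_one, Finset.sum_sub_distrib, hsum, h1, sub_self]
  have h3 := (Finset.sum_eq_zero_iff_of_nonneg fun a ha =>
    mul_nonneg (hp a ha) (sub_nonneg.2 (Real.cos_le_one _))).1 h2
  have h4 : ∀ a ∈ S, (p a : ℂ) * Complex.exp (-(Complex.I * ((n * b : ℝ) : ℂ) * a)) = p a := by
    intro a ha
    rcases mul_eq_zero.1 (h3 a ha) with h | h
    · simp [h]
    · have hc : Real.cos (b * a) = 1 := by linarith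
      have hs : Real.sin (b * a) = 0 := by
        have := Real.sin_sq_add_cos_sq (b * a)
        rw [hc] at this
        nlinarith
      have he : Complex.exp (-(Complex.I * b * a)) = 1 := by
        apply Complex.ext
        · rw [Complex.exp_re]; simp [hc]
        · rw [Complex.exp_im]; simp [hs]
      rw [show -(Complex.I * ((n * b : ℝ) : ℂ) * a) = n * (-(Complex.I * b * a)) by
        push_cast; ring, Complex.exp_nat_mul, he]
      simp
  rw [expSum, Finset.sum_congr rfl h4, ← Complex.ofReal_sum, hsum, Complex.ofReal_one]

/-- At `0` the value is the mean. A zero at `w ≠ 0` would give `ℒλ = 1` at all integer multiples of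
`2πiw`, against the diophantine bound at large frequency. -/
lemma fourier_tailFun_ne_zero (hS : ∀ a ∈ S, 0 < a) (hp : ∀ a ∈ S, 0 ≤ p a)
    (hsum : ∑ a ∈ S, p a = 1) {l c B : ℝ} (hc : 0 < c)
    (hL : ∀ b, B ≤ |b| → c < |b| ^ l * ‖1 - expSum S p b‖) (w : ℝ) :
    𝓕 (tailFun S p) w ≠ 0 := by
  rcases eq_or_ne w 0 with rfl | hw
  · rw [fourier_tailFun_zero hS]
    have hpos : 0 < ∑ a ∈ S, p a * a := by
      obtain ⟨a, ha, hpa⟩ : ∃ a ∈ S, p a ≠ 0 := by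
        by_contra! h
        rw [Finset.sum_congr rfl h] at hsum
        simp at hsum
      exact Finset.sum_pos' (fun a ha => mul_nonneg (hp a ha) (hS a ha).le)
        ⟨a, ha, mul_pos (lt_of_le_of_ne (hp a ha) (Ne.symm hpa)) (hS a ha)⟩
    exact_mod_cast hpos.ne'
  · intro h
    have h1 : expSum S p (2 * π * w) = 1 := by
      have := mul_fourier_tailFun hS hsum w
      rw [h, mul_zero] at this
      exact (sub_eq_zero.1 this.symm).symm
    have hw' : 0 < |2 * π * w| := abs_pos.2 (by simp [Real.pi_ne_zero, hw])
    obtain ⟨n, hn⟩ := exists_nat_ge (B / |2 * π * w|)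
    have h2 := hL (n * (2 * π * w)) (by
      rw [div_le_iff₀ hw'] at hn
      rwa [abs_mul, Nat.abs_cast])
    rw [expSum_nat_mul hp hsum h1 n, sub_self, norm_zero, mul_zero] at h2
    exact hc.not_gt h2

/-- Continuity and nonvanishing handle a compact interval. Outside it, dividing `1 - ℒλ` by `2πiw`
adds one to the diophantine exponent. -/
lemma norm_inv_fourier_tailFun_le (hS : ∀ a ∈ S, 0 < a) (hp : ∀ a ∈ S, 0 ≤ p a)
    (hsum : ∑ a ∈ S, p a = 1) {l c B : ℝ} (hl : 0 < l) (hc : 0 < c)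
    (hL : ∀ b, B ≤ |b| → c < |b| ^ l * ‖1 - expSum S p b‖) :
    ∃ C : ℝ, ∀ w : ℝ, ‖(𝓕 (tailFun S p) w)⁻¹‖ ≤ C * (1 + |w|) ^ (1 + l) := by
  have hne := fourier_tailFun_ne_zero hS hp hsum hc hL
  have hcont : Continuous fun w => (𝓕 (tailFun S p) w)⁻¹ :=
    ((derivBound_fourier_tailFun hS hsum 1).2.1 ()).continuous.inv₀ hne
  obtain ⟨D, hD⟩ := (isCompact_Icc (a := -|B|) (b := |B|)).exists_bound_of_continuousOn
    hcont.continuousOn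
  have h1w : ∀ w : ℝ, 1 ≤ 1 + |w| := fun w => by linarith [abs_nonneg w]
  have hge : ∀ w : ℝ, (1 : ℝ) ≤ (1 + |w|) ^ (1 + l) := fun w =>
    Real.one_le_rpow (h1w w) (by linarith)
  refine ⟨|D| + (2 * π) ^ (1 + l) / c, fun w => ?_⟩
  by_cases hw : |w| ≤ |B|
  · have := hD w (abs_le.1 hw)
    calc _ ≤ |D| := this.trans (le_abs_self D)
      _ ≤ (|D| + (2 * π) ^ (1 + l) / c) * 1 := by
        have : 0 ≤ (2 * π) ^ (1 + l) / c := by positivity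
        linarith
      _ ≤ _ := mul_le_mul_of_nonneg_left (hge w) (by positivity)
  · push Not at hw
    have hw0 : 0 < |w| := (abs_nonneg B).trans_lt hw
    have hpi : |2 * π * w| = 2 * π * |w| := by
      rw [abs_mul, abs_of_pos (by positivity : 0 < 2 * π)]
    have h2 := hL (2 * π * w) (by
      rw [hpi]
      nlinarith [le_abs_self B, Real.pi_gt_three])
    rw [← mul_fourier_tailFun hS hsum, hpi] at h2
    rw [norm_mul] at h2
    have hn : ‖(2 * π * Complex.I * w : ℂ)‖ = 2 * π * |w| := by
      simp [abs_of_pos Real.pi_pos]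
    rw [hn, ← mul_assoc] at h2
    nth_rewrite 2 [← Real.rpow_one (2 * π * |w|)] at h2
    rw [← Real.rpow_add (by positivity)] at h2
    have hm : 0 < ‖𝓕 (tailFun S p) w‖ := norm_pos_iff.2 (hne w)
    have h3 : ‖(𝓕 (tailFun S p) w)⁻¹‖ ≤ (2 * π * |w|) ^ (1 + l) / c := by
      rw [norm_inv, inv_le_comm₀ hm (by positivity), inv_div, div_le_iff₀ (by positivity),
        add_comm 1 l, mul_comm]
      exact h2.le
    calc _ ≤ (2 * π * |w|) ^ (1 + l) / c := h3
      _ = (2 * π) ^ (1 + l) / c * |w| ^ (1 + l) := by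
        rw [Real.mul_rpow (by positivity) (by positivity)]
        ring
      _ ≤ (2 * π) ^ (1 + l) / c * (1 + |w|) ^ (1 + l) := by
        gcongr
        linarith
      _ ≤ _ := by
        gcongr
        exact le_add_of_nonneg_left (abs_nonneg D)

/-- Three uses of `inv_of_bound` double the excess each time: `l`, `2l`, `4l`, `8l`. -/
lemma derivBound_inv_fourier_tailFun (hS : ∀ a ∈ S, 0 < a) (hp : ∀ a ∈ S, 0 ≤ p a)
    (hsum : ∑ a ∈ S, p a = 1) {l c B : ℝ} (hl : 0 < l) (hc : 0 < c)
    (hL : ∀ b, B ≤ |b| → c < |b| ^ l * ‖1 - expSum S p b‖) :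
    DerivBound 3 (fun (_ : Unit) w => (1 + |w|) ^ (1 + 8 * l))
      (fun _ w => (𝓕 (tailFun S p) w)⁻¹) := by
  have hne : ∀ (_ : Unit) w, 𝓕 (tailFun S p) w ≠ 0 := fun _ =>
    fourier_tailFun_ne_zero hS hp hsum hc hL
  have hm := fun k => derivBound_fourier_tailFun hS hsum k
  obtain ⟨C, hC⟩ := norm_inv_fourier_tailFun_le hS hp hsum hl hc hL
  have h0 : DerivBound 0 (fun (_ : Unit) w => (1 + |w|) ^ (1 + l))
      (fun _ w => (𝓕 (tailFun S p) w)⁻¹) := ⟨C, fun _ => hC⟩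
  have h1 := DerivBound.inv_of_bound hl.le hne (hm 1) h0
  have h2 := DerivBound.inv_of_bound (by positivity) hne (hm 2) h1
  have h3 := DerivBound.inv_of_bound (by positivity) hne (hm 3) h2
  rw [show 2 * (2 * (2 * l)) = 8 * l by ring] at h3
  exact h3

end

/-! ### Choice of scale and the mollified bound -/

/-- The mollification scale adapted to the time `t`. -/
noncomputable def scale (l t : ℝ) : ℝ := t ^ (-(1 / (4 * l + 1))) / 2

section

variable {S : Finset ℝ} {p : ℝ → ℝ}

lemma scale_pos {l t : ℝ} (ht : 0 < t) : 0 < scale l t := by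
  unfold scale; positivity

lemma scale_le_half {l t : ℝ} (hl : 0 < l) (ht : 1 ≤ t) : scale l t ≤ 1 / 2 := by
  have : t ^ (-(1 / (4 * l + 1))) ≤ 1 := Real.rpow_le_one_of_one_le_of_nonpos ht
    (by rw [neg_nonpos]; positivity)
  unfold scale
  linarith

lemma inv_eq_scale_rpow {l t : ℝ} (hl : 0 < l) (ht : 0 < t) :
    t⁻¹ = (2 * scale l t) ^ (4 * l + 1) := by
  rw [scale, mul_div_cancel₀ _ (two_ne_zero), ← Real.rpow_mul ht.le, ← Real.rpow_neg_one]
  congr 1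
  field_simp

/-- Mollification at scale `scale l t` of a bounded solution `H` of `T * H = W`. -/
theorem exists_mollified_bound (hS : ∀ a ∈ S, 0 < a) (hp : ∀ a ∈ S, 0 ≤ p a)
    (hsum : ∑ a ∈ S, p a = 1) {l c B : ℝ} (hl : 0 < l) (hc : 0 < c)
    (hL : ∀ b, B ≤ |b| → c < |b| ^ l * ‖1 - expSum S p b‖) (φ : 𝓢(ℝ, ℂ)) {M : ℝ} (hM : 0 ≤ M) :
    ∃ K : ℝ, 0 ≤ K ∧ ∀ (t t' : ℝ), M + 1 < t → t - scale l t ≤ t' →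
      ∀ (H W : ℝ → ℂ) (A D : ℝ), Measurable H → (∀ x, ‖H x‖ ≤ A) →
        (∀ s, ∫ y, tailFun S p y * H (s - y) = W s) → (∀ s, ‖W s‖ ≤ D) →
        (∀ s, s ∉ Icc 0 M → W s = 0) →
        ‖∫ v, φ v * H (t' - scale l t * v)‖ ≤ K * scale l t * D := by
  obtain ⟨C, hC0, hC⟩ := exists_kernel φ (integrable_tailFun (S := S) (p := p))
    (by positivity : 0 ≤ 1 + 8 * l) (fourier_tailFun_ne_zero hS hp hsum hc hL)
    (derivBound_inv_fourier_tailFun hS hp hsum hl hc hL)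
  refine ⟨C * ((2 * (M + 1)) ^ 3 * (2 ^ (4 * l + 1)) ^ 3) * M, by positivity,
    fun t t' ht ht' H W A D hH hHA hHW hWD hW0 => ?_⟩
  have ht1 : 1 < t := by linarith
  set δ := scale l t with hδdef
  have hδ : 0 < δ := scale_pos (by linarith)
  have hδ2 : δ ≤ 1 / 2 := scale_le_half hl ht1.le
  obtain ⟨R, hRc, hRb, hRT⟩ := hC δ hδ (by linarith)
  have hD : 0 ≤ D := (norm_nonneg _).trans (hWD 0)
  have hRint : Integrable R := by
    have h3 : Integrable (fun x : ℝ => (1 + ‖x‖) ^ (-3 : ℝ)) :=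
      integrable_one_add_norm (by norm_num)
    refine (h3.const_mul (C * δ ^ (-(1 + 8 * l + 1)))).mono' hRc.aestronglyMeasurable
      (Eventually.of_forall fun x => ?_)
    rw [Real.rpow_neg (x := 1 + ‖x‖) (by positivity), ← div_eq_mul_inv (C * _),
      le_div_iff₀ (by positivity)]
    exact_mod_cast hRb x
  have hmain := integral_kernel_mul hRint (integrable_tailFun (S := S) (p := p)) hH hHA hHW hRT t'
  have hsub : ∫ v, φ v * H (t' - δ * v) = ∫ u, (δ : ℂ)⁻¹ * φ (u / δ) * H (t' - u) := by
    have h := Measure.integral_comp_mul_left (fun u : ℝ => (δ : ℂ)⁻¹ * φ (u / δ) * H (t' - u)) δ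
    rw [abs_of_pos (inv_pos.2 hδ)] at h
    have hδc : (δ : ℂ) ≠ 0 := by exact_mod_cast hδ.ne'
    calc ∫ v, φ v * H (t' - δ * v)
        = ∫ v, (δ : ℂ) * ((δ : ℂ)⁻¹ * φ (δ * v / δ) * H (t' - δ * v)) := by
          congr 1 with v
          rw [mul_div_cancel_left₀ _ hδ.ne']
          field_simp
      _ = _ := by
          rw [integral_const_mul, h, Complex.real_smul, ← mul_assoc, Complex.ofReal_inv,
            mul_inv_cancel₀ hδc, one_mul]
  rw [hsub, hmain]
  have hflip : ∫ v, R v * W (t' - v) = ∫ s in Icc 0 M, R (t' - s) * W s := by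
    rw [← integral_sub_left_eq_self _ volume t', setIntegral_eq_integral_of_forall_compl_eq_zero]
    · simp only [sub_sub_cancel]
    · intro s hs
      rw [hW0 s hs, mul_zero]
  rw [hflip]
  have hbound : ∀ s ∈ Icc 0 M, ‖R (t' - s) * W s‖ ≤
      C * ((2 * (M + 1)) ^ 3 * (2 ^ (4 * l + 1)) ^ 3) * δ * D := by
    intro s hs
    -- As `t > M + 1` and `δ ≤ 1/2`, the kernel is evaluated at distance comparable to `t`, where
    -- its cubic decay applies.
    have hx : t / (2 * (M + 1)) ≤ t' - s := by
      rw [div_le_iff₀ (by positivity)]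
      have h1 : t - 1 / 2 - M ≤ t' - s := by linarith [hs.2]
      nlinarith
    have hx0 : 0 < t / (2 * (M + 1)) := by positivity
    have h1 : ‖R (t' - s)‖ * (t / (2 * (M + 1))) ^ 3 ≤ C * δ ^ (-(1 + 8 * l + 1)) := by
      refine le_trans ?_ (hRb (t' - s))
      gcongr
      rw [abs_of_pos (hx0.trans_le hx)]
      linarith
    have h2 : ‖R (t' - s)‖ ≤ C * δ ^ (-(1 + 8 * l + 1)) * ((2 * (M + 1)) ^ 3 * t⁻¹ ^ 3) := by
      rw [div_pow, ← mul_div_assoc, div_le_iff₀ (by positivity)] at h1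
      rw [inv_pow, ← mul_assoc, ← div_eq_mul_inv, le_div_iff₀ (by positivity)]
      exact h1
    -- The exponents add up to `-(2 + 8l) + 3(4l + 1) = 4l + 1 ≥ 1`. With two derivatives the same
    -- count gives `-(2 + 4l) + 2(4l + 1) = 4l`, too little for small `l`.
    have h3 : δ ^ (-(1 + 8 * l + 1)) * (δ ^ (4 * l + 1)) ^ 3 ≤ δ := by
      rw [← Real.rpow_natCast (δ ^ (4 * l + 1)), ← Real.rpow_mul hδ.le, ← Real.rpow_add hδ]
      calc δ ^ (-(1 + 8 * l + 1) + (4 * l + 1) * (3 : ℕ)) ≤ δ ^ (1 : ℝ) :=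
            Real.rpow_le_rpow_of_exponent_ge hδ (by linarith) (by push_cast; linarith)
        _ = δ := Real.rpow_one δ
    rw [inv_eq_scale_rpow hl (by linarith), Real.mul_rpow zero_le_two hδ.le] at h2
    rw [norm_mul]
    calc ‖R (t' - s)‖ * ‖W s‖
        ≤ (C * δ ^ (-(1 + 8 * l + 1)) *
          ((2 * (M + 1)) ^ 3 * (2 ^ (4 * l + 1) * δ ^ (4 * l + 1)) ^ 3)) * D :=
          mul_le_mul h2 (hWD s) (norm_nonneg _) (by positivity)
      _ = C * ((2 * (M + 1)) ^ 3 * (2 ^ (4 * l + 1)) ^ 3) *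
          (δ ^ (-(1 + 8 * l + 1)) * (δ ^ (4 * l + 1)) ^ 3) * D := by ring
      _ ≤ C * ((2 * (M + 1)) ^ 3 * (2 ^ (4 * l + 1)) ^ 3) * δ * D := by gcongr
  refine (norm_setIntegral_le_of_norm_le_const (by simp) hbound).trans (le_of_eq ?_)
  rw [Real.volume_real_Icc_of_le hM]
  ring

/-! ### Paths of the walk -/

variable {Ω : Type*} {X : ℕ → Ω → ℝ} {ω : Ω} {r M t s : ℝ}

lemma walk_zero : walk X 0 ω = 0 := by simp [walk]

lemma walk_succ (n : ℕ) : walk X (n + 1) ω = walk X n ω + X n ω := by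
  simp [walk, Finset.sum_range_succ]

lemma mul_le_walk (hX : ∀ n, r ≤ X n ω) (n : ℕ) : n * r ≤ walk X n ω := by
  induction n with
  | zero => simp [walk_zero]
  | succ n ih =>
    rw [walk_succ]
    push_cast
    linarith [hX n]

lemma walk_strictMono (hr : 0 < r) (hX : ∀ n, r ≤ X n ω) : StrictMono fun n => walk X n ω :=
  strictMono_nat_of_lt_succ fun n => by
    rw [walk_succ]
    linarith [hX n]

lemma exists_le_walk (hr : 0 < r) (hX : ∀ n, r ≤ X n ω) (t : ℝ) : ∃ n, t ≤ walk X n ω := by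
  obtain ⟨n, hn⟩ := exists_nat_ge (t / r)
  exact ⟨n, ((div_le_iff₀ hr).1 hn).trans (mul_le_walk hX n)⟩

lemma le_walk_stopTime (hr : 0 < r) (hX : ∀ n, r ≤ X n ω) (t : ℝ) :
    t ≤ walk X (stopTime X t ω) ω :=
  Nat.sInf_mem (s := {n | t ≤ walk X n ω}) (exists_le_walk hr hX t)

lemma stopTime_le {n : ℕ} (h : t ≤ walk X n ω) : stopTime X t ω ≤ n := Nat.sInf_le h

lemma walk_lt_of_lt_stopTime {n : ℕ} (h : n < stopTime X t ω) : walk X n ω < t := by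
  by_contra! hn
  exact absurd (stopTime_le hn) (not_le.2 h)

lemma overshoot_nonneg (hr : 0 < r) (hX : ∀ n, r ≤ X n ω) (t : ℝ) : 0 ≤ overshoot X t ω :=
  sub_nonneg.2 (le_walk_stopTime hr hX t)

lemma exists_stopTime_eq_succ (hr : 0 < r) (hX : ∀ n, r ≤ X n ω) (ht : 0 < t) :
    ∃ n, stopTime X t ω = n + 1 ∧ walk X n ω < t ∧ t ≤ walk X n ω + X n ω := by
  have h := le_walk_stopTime hr hX t
  obtain ⟨n, hn⟩ := Nat.exists_eq_succ_of_ne_zero (n := stopTime X t ω) fun h0 => by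
    rw [h0, walk_zero] at h
    linarith
  refine ⟨n, hn, walk_lt_of_lt_stopTime (by omega), ?_⟩
  rwa [hn, Nat.succ_eq_add_one, walk_succ] at h

lemma overshoot_le (hr : 0 < r) (hX : ∀ n, r ≤ X n ω) (hXM : ∀ n, X n ω ≤ M) (ht : 0 < t) :
    overshoot X t ω ≤ M := by
  obtain ⟨n, hn, h1, h2⟩ := exists_stopTime_eq_succ hr hX ht
  rw [overshoot, hn, walk_succ]
  linarith [hXM n]

/-- For `t > 0` exactly one step crosses `t`, and it is among the first `N` because each step is at
least `r`. This makes the overshoot a finite sum of functions of a position and the next,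
independent, step. -/
lemma sum_overshoot (hr : 0 < r) (hX : ∀ n, r ≤ X n ω) (g : ℝ → ℂ) {N : ℕ} (ht : t ≤ N * r) :
    ∑ n ∈ Finset.range N, (if walk X n ω < t ∧ t ≤ walk X n ω + X n ω
      then g (walk X n ω + X n ω - t) else 0) = if 0 < t then g (overshoot X t ω) else 0 := by
  have hmono := walk_strictMono hr hX
  split_ifs with h0
  · obtain ⟨n, hn, h1, h2⟩ := exists_stopTime_eq_succ hr hX h0
    have hnN : n < N := by
      by_contra! h
      have h3 : (N : ℝ) * r ≤ walk X n ω := (mul_le_walk hX N).trans (hmono.monotone h)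
      linarith
    rw [Finset.sum_eq_single_of_mem n (Finset.mem_range.2 hnN), if_pos ⟨h1, h2⟩, overshoot, hn,
      walk_succ]
    intro m _ hmn
    refine if_neg fun ⟨h3, h4⟩ => ?_
    rcases lt_or_gt_of_ne hmn with h | h
    · have := hmono.monotone (Nat.succ_le_of_lt h)
      simp only [Nat.succ_eq_add_one, walk_succ] at this
      linarith
    · have := hmono.monotone (Nat.succ_le_of_lt h)
      simp only [Nat.succ_eq_add_one, walk_succ] at this
      linarith
  · refine Finset.sum_eq_zero fun n _ => if_neg fun ⟨h1, _⟩ => ?_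
    have := hmono.monotone (Nat.zero_le n)
    simp only [walk_zero] at this
    linarith

/-- Pathwise form of `T * U = 1_{[0, ∞)}`: the intervals `[S_n, S_{n+1})` are disjoint and cover the
half-line, so the sum telescopes. -/
lemma sum_occupation (hr : 0 < r) (hX : ∀ n, r ≤ X n ω) {N : ℕ} (hs : s < N * r) :
    ∑ n ∈ Finset.range N, (if walk X n ω ≤ s ∧ s < walk X n ω + X n ω then (1 : ℂ) else 0) =
      if 0 ≤ s then 1 else 0 := by
  have h1 : ∀ n, (if walk X n ω ≤ s ∧ s < walk X n ω + X n ω then (1 : ℂ) else 0) =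
      (if walk X n ω ≤ s then 1 else 0) - (if walk X (n + 1) ω ≤ s then 1 else 0) := by
    intro n
    rw [walk_succ]
    have := hX n
    split_ifs <;> grind
  rw [Finset.sum_congr rfl fun n _ => h1 n, Finset.sum_range_sub', walk_zero,
    if_neg (c := walk X N ω ≤ s) (by have := mul_le_walk hX N; linarith), sub_zero]

lemma walk_stopTime_mono (hr : 0 < r) (hX : ∀ n, r ≤ X n ω) :
    Monotone fun t => walk X (stopTime X t ω) ω := fun _ t' htt' =>
  (walk_strictMono hr hX).monotone (stopTime_le (htt'.trans (le_walk_stopTime hr hX t')))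

/-- The first passage position over `t` falls short of `t + u`, so at least one further step is
needed. -/
lemma le_walk_stopTime_sub (hr : 0 < r) (hX : ∀ n, r ≤ X n ω) {u : ℝ}
    (h : overshoot X t ω < u) :
    r ≤ walk X (stopTime X (t + u) ω) ω - walk X (stopTime X t ω) ω := by
  have h1 := le_walk_stopTime hr hX (t + u)
  have hmono := walk_strictMono hr hX
  have h2 : stopTime X t ω < stopTime X (t + u) ω := by
    rw [← hmono.lt_iff_lt]
    simp only [overshoot] at h ⊢
    linarith
  have h3 := hmono.monotone (Nat.succ_le_of_lt h2)
  simp only [Nat.succ_eq_add_one, walk_succ] at h3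
  linarith [hX (stopTime X t ω)]

/-- The complementary case: the step crossing `t` also crosses `t + u`, so the stopping index is
unchanged. -/
lemma overshoot_add (hr : 0 < r) (hX : ∀ n, r ≤ X n ω) {u : ℝ} (hu : 0 ≤ u)
    (h : u ≤ overshoot X t ω) : overshoot X (t + u) ω = overshoot X t ω - u := by
  have h1 : stopTime X (t + u) ω = stopTime X t ω := by
    apply le_antisymm
    · apply stopTime_le
      simp only [overshoot] at h
      linarith
    · apply stopTime_le
      linarith [le_walk_stopTime hr hX (t + u)]
  rw [overshoot, overshoot, h1]
  ring

end

/-! ### The renewal equation -/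

/-- The contribution `y ↦ E (g (X - y); 0 < y ≤ X)` of one renewal to the law of the overshoot. -/
noncomputable def ladderFun (S : Finset ℝ) (p : ℝ → ℝ) (g : ℝ → ℂ) (y : ℝ) : ℂ :=
  ∑ a ∈ S, (p a : ℂ) * (Ioc 0 a).indicator (fun y => g (a - y)) y

/-- The expectation of `g` at the overshoot over `t`, extended by `0` to `t ≤ 0`. -/
noncomputable def overshootMean {Ω : Type*} [MeasurableSpace Ω] (P : Measure Ω) (X : ℕ → Ω → ℝ) (g : ℝ → ℂ)
    (t : ℝ) : ℂ :=
  if 0 < t then ∫ ω, g (overshoot X t ω) ∂P else 0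

section

variable {S : Finset ℝ} {p : ℝ → ℝ} {g : ℝ → ℂ}

lemma measurable_tailFun : Measurable (tailFun S p) := by
  unfold tailFun
  exact Finset.measurable_fun_sum _ fun a _ =>
    (measurable_const.indicator measurableSet_Ico).const_mul _

lemma measurable_ladderFun (hg : Measurable g) : Measurable (ladderFun S p g) := by
  unfold ladderFun
  exact Finset.measurable_fun_sum _ fun a _ =>
    ((hg.comp (measurable_const.sub measurable_id)).indicator measurableSet_Ioc).const_mul _

lemma tailFun_of_neg {x : ℝ} (hx : x < 0) : tailFun S p x = 0 :=
  Finset.sum_eq_zero fun a _ => by simp [hx.not_ge]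

lemma tailFun_of_le {M x : ℝ} (hM : ∀ a ∈ S, a ≤ M) (hx : M ≤ x) : tailFun S p x = 0 :=
  Finset.sum_eq_zero fun a ha => by simp [((hM a ha).trans hx).not_gt]

lemma ladderFun_of_nonpos {x : ℝ} (hx : x ≤ 0) : ladderFun S p g x = 0 :=
  Finset.sum_eq_zero fun a _ => by simp [hx.not_gt]

lemma ladderFun_of_lt {M x : ℝ} (hM : ∀ a ∈ S, a ≤ M) (hx : M < x) : ladderFun S p g x = 0 :=
  Finset.sum_eq_zero fun a ha => by simp [((hM a ha).trans_lt hx).not_ge]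

lemma norm_tailFun_le (hp : ∀ a ∈ S, 0 ≤ p a) (hsum : ∑ a ∈ S, p a = 1) (x : ℝ) :
    ‖tailFun S p x‖ ≤ 1 := by
  rw [tailFun, ← hsum]
  refine norm_sum_le_of_le _ fun a ha => ?_
  rw [norm_mul, Complex.norm_real, Real.norm_of_nonneg (hp a ha)]
  by_cases h : x ∈ Ico 0 a <;> simp [h, hp a ha]

lemma norm_ladderFun_le (hp : ∀ a ∈ S, 0 ≤ p a) (hsum : ∑ a ∈ S, p a = 1) {B : ℝ}
    (hg : ∀ x, ‖g x‖ ≤ B) (x : ℝ) : ‖ladderFun S p g x‖ ≤ B := by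
  rw [ladderFun, ← one_mul B, ← hsum, Finset.sum_mul]
  refine norm_sum_le_of_le _ fun a ha => ?_
  rw [norm_mul, Complex.norm_real, Real.norm_of_nonneg (hp a ha)]
  refine mul_le_mul_of_nonneg_left ?_ (hp a ha)
  by_cases h : x ∈ Ioc 0 a
  · simpa [h] using hg (a - x)
  · simpa [h] using (norm_nonneg _).trans (hg x)

lemma norm_ladderFun_le_indicator (hp : ∀ a ∈ S, 0 ≤ p a) (hsum : ∑ a ∈ S, p a = 1) {B M : ℝ}
    (hM : ∀ a ∈ S, a ≤ M) (hg : ∀ x, ‖g x‖ ≤ B) (x : ℝ) :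
    ‖ladderFun S p g x‖ ≤ (Icc 0 M).indicator (fun _ => B) x := by
  by_cases h : x ∈ Icc 0 M
  · simpa [h] using norm_ladderFun_le hp hsum hg x
  · rw [indicator_of_notMem h]
    rcases lt_or_ge x 0 with h0 | h0
    · rw [ladderFun_of_nonpos h0.le, norm_zero]
    · rw [ladderFun_of_lt hM (lt_of_not_ge fun h1 => h ⟨h0, h1⟩), norm_zero]

lemma integrable_ladderFun (hp : ∀ a ∈ S, 0 ≤ p a) (hsum : ∑ a ∈ S, p a = 1) {B M : ℝ}
    (hM : ∀ a ∈ S, a ≤ M) (hgm : Measurable g) (hg : ∀ x, ‖g x‖ ≤ B) :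
    Integrable (ladderFun S p g) := by
  refine Integrable.mono' (g := (Icc 0 M).indicator fun _ => B) ?_
    (measurable_ladderFun hgm).aestronglyMeasurable
    (Eventually.of_forall (norm_ladderFun_le_indicator hp hsum hM hg))
  exact (integrableOn_const (by simp)).integrable_indicator measurableSet_Icc

/-- The substitution `x = a - y` at each atom identifies the total mass of the one-step contribution
with the integral in the limit. -/
lemma integral_ladderFun (hS : ∀ a ∈ S, 0 < a) {B : ℝ} (hgm : Measurable g)
    (hg : ∀ x, ‖g x‖ ≤ B) :
    ∫ y, ladderFun S p g y = ∫ x in Ioi 0, g x * tailFun S p x := by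
  have hgint : ∀ s : Set ℝ, volume s ≠ ⊤ → IntegrableOn g s := fun s hs =>
    Measure.integrableOn_of_bounded hs hgm.aestronglyMeasurable (Eventually.of_forall hg)
  have hgint' : ∀ a, IntegrableOn (fun y => g (a - y)) (Ioc 0 a) := fun a =>
    Measure.integrableOn_of_bounded (by simp) (hgm.comp
      (measurable_const.sub measurable_id)).aestronglyMeasurable
      (Eventually.of_forall fun _ => hg _)
  have h1 : ∀ x, g x * tailFun S p x =
      ∑ a ∈ S, (p a : ℂ) * (Ico 0 a).indicator g x := by
    intro x
    rw [tailFun, Finset.mul_sum]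
    refine Finset.sum_congr rfl fun a _ => ?_
    by_cases h : x ∈ Ico 0 a <;> simp [h, mul_comm]
  simp only [ladderFun, h1]
  rw [integral_finsetSum, integral_finsetSum]
  · refine Finset.sum_congr rfl fun a ha => ?_
    rw [integral_const_mul, integral_const_mul, integral_indicator measurableSet_Ioc,
      setIntegral_indicator measurableSet_Ico,
      ← intervalIntegral.integral_of_le (hS a ha).le,
      intervalIntegral.integral_comp_sub_left (fun x => g x) a, sub_self, sub_zero,
      intervalIntegral.integral_of_le (hS a ha).le, integral_Ioc_eq_integral_Ioo]
    congr 3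
    ext x
    simp only [mem_Ioo, mem_inter_iff, mem_Ioi, mem_Ico]
    constructor
    · rintro ⟨h1, h2⟩; exact ⟨h1, h1.le, h2⟩
    · rintro ⟨h1, -, h2⟩; exact ⟨h1, h2⟩
  · intro a _
    exact (((hgint (Ico 0 a) (by simp)).integrable_indicator measurableSet_Ico).const_mul
      _).integrableOn
  · intro a _
    exact ((hgint' a).integrable_indicator measurableSet_Ioc).const_mul _

end

lemma ae_forall_step {S : Finset ℝ} {lam : Measure ℝ} {Ω : Type*} [MeasurableSpace Ω]
    {P : Measure Ω} {X : ℕ → Ω → ℝ} (hXm : ∀ n, Measurable (X n)) (hlaw : ∀ n, P.map (X n) = lam)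
    (hlamS : ∀ᵐ x ∂lam, x ∈ S) : ∀ᵐ ω ∂P, ∀ n, X n ω ∈ S := by
  rw [ae_all_iff]
  intro n
  rw [← hlaw n] at hlamS
  exact ae_of_ae_map (hXm n).aemeasurable hlamS

section

variable {S : Finset ℝ} {p : ℝ → ℝ} {lam : Measure ℝ} [IsProbabilityMeasure lam]
  {Ω : Type*} [MeasurableSpace Ω] {P : Measure Ω} [IsProbabilityMeasure P] {X : ℕ → Ω → ℝ}
  {r M : ℝ} {g : ℝ → ℂ} {B : ℝ}

lemma measurable_walk (hXm : ∀ n, Measurable (X n)) (n : ℕ) : Measurable (walk X n) := by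
  unfold walk
  exact Finset.measurable_fun_sum _ fun i _ => hXm i

/-- Conditioning on the position of the walk before a step. -/
lemma integral_walk_step (hXm : ∀ n, Measurable (X n)) (hind : iIndepFun X P)
    (hlaw : ∀ n, P.map (X n) = lam)
    (hlam : ∀ f : ℝ → ℂ, ∫ x, f x ∂lam = ∑ a ∈ S, (p a : ℂ) * f a)
    {F : ℝ × ℝ → ℂ} (hF : Measurable F) (hFB : ∀ z, ‖F z‖ ≤ B) (n : ℕ) :
    ∫ ω, F (walk X n ω, X n ω) ∂P = ∫ ω, ∑ a ∈ S, (p a : ℂ) * F (walk X n ω, a) ∂P := by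
  have hw := measurable_walk hXm n
  have hi : IndepFun (walk X n) (X n) P := by
    have := hind.indepFun_sum_range_succ hXm n
    convert! this using 1
    ext ω
    simp [walk]
  have hmap := (indepFun_iff_map_prod_eq_prod_map_map hw.aemeasurable
    (hXm n).aemeasurable).1 hi
  have : IsProbabilityMeasure (P.map (walk X n)) := Measure.isProbabilityMeasure_map hw.aemeasurable
  have hFi : Integrable F ((P.map (walk X n)).prod lam) :=
    Integrable.of_bound hF.aestronglyMeasurable B (Eventually.of_forall hFB)
  calc ∫ ω, F (walk X n ω, X n ω) ∂P = ∫ z, F z ∂(P.map fun ω => (walk X n ω, X n ω)) :=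
        (integral_map (hw.prodMk (hXm n)).aemeasurable hF.aestronglyMeasurable).symm
    _ = ∫ z, F z ∂((P.map (walk X n)).prod lam) := by rw [hmap, hlaw]
    _ = ∫ s, ∑ a ∈ S, (p a : ℂ) * F (s, a) ∂(P.map (walk X n)) := by
        rw [integral_prod _ hFi]
        simp only [hlam]
    _ = _ := by
        refine integral_map hw.aemeasurable (Measurable.aestronglyMeasurable ?_)
        exact Finset.measurable_fun_sum _ fun a _ =>
          (hF.comp (measurable_id.prodMk measurable_const)).const_mul _

lemma overshootMean_eq_sum (hXm : ∀ n, Measurable (X n)) (hind : iIndepFun X P)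
    (hlaw : ∀ n, P.map (X n) = lam)
    (hlam : ∀ f : ℝ → ℂ, ∫ x, f x ∂lam = ∑ a ∈ S, (p a : ℂ) * f a)
    (hr : 0 < r) (hX : ∀ᵐ ω ∂P, ∀ n, r ≤ X n ω) (hgm : Measurable g) (hg : ∀ x, ‖g x‖ ≤ B)
    {t : ℝ} {N : ℕ} (ht : t ≤ N * r) :
    overshootMean P X g t = ∑ n ∈ Finset.range N, ∫ ω, ladderFun S p g (t - walk X n ω) ∂P := by
  classical
  set F : ℝ × ℝ → ℂ := fun z => if z.1 < t ∧ t ≤ z.1 + z.2 then g (z.1 + z.2 - t) else 0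
  have hset : MeasurableSet {z : ℝ × ℝ | z.1 < t ∧ t ≤ z.1 + z.2} :=
    (measurableSet_lt measurable_fst measurable_const).inter
      (measurableSet_le measurable_const (measurable_fst.add measurable_snd))
  have hF : Measurable F := Measurable.ite hset (hgm.comp (by fun_prop)) measurable_const
  have hFB : ∀ z, ‖F z‖ ≤ B := by
    intro z
    simp only [F]
    split_ifs
    · exact hg _
    · simpa using (norm_nonneg _).trans (hg 0)
  have hstep : ∀ n, ∫ ω, ladderFun S p g (t - walk X n ω) ∂P =
      ∫ ω, F (walk X n ω, X n ω) ∂P := by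
    intro n
    rw [integral_walk_step hXm hind hlaw hlam hF hFB n]
    congr 1 with ω
    refine Finset.sum_congr rfl fun a _ => ?_
    congr 1
    simp only [F, indicator, mem_Ioc, sub_pos, sub_le_iff_le_add']
    simp only [sub_sub_eq_add_sub, add_comm a]
  rw [Finset.sum_congr rfl fun n _ => hstep n, ← integral_finsetSum]
  · rw [overshootMean]
    have : ∀ᵐ ω ∂P, ∑ n ∈ Finset.range N, F (walk X n ω, X n ω) =
        if 0 < t then g (overshoot X t ω) else 0 := by
      filter_upwards [hX] with ω hω
      exact sum_overshoot hr hω g ht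
    rw [integral_congr_ae this]
    split_ifs <;> simp
  · intro n _
    exact Integrable.of_bound (hF.comp ((measurable_walk hXm n).prodMk
      (hXm n))).aestronglyMeasurable B (Eventually.of_forall fun ω => hFB _)

lemma sum_integral_tailFun (hXm : ∀ n, Measurable (X n)) (hind : iIndepFun X P)
    (hlaw : ∀ n, P.map (X n) = lam)
    (hlam : ∀ f : ℝ → ℂ, ∫ x, f x ∂lam = ∑ a ∈ S, (p a : ℂ) * f a)
    (hr : 0 < r) (hX : ∀ᵐ ω ∂P, ∀ n, r ≤ X n ω) {s : ℝ} {N : ℕ} (hs : s < N * r) :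
    ∑ n ∈ Finset.range N, ∫ ω, tailFun S p (s - walk X n ω) ∂P = if 0 ≤ s then 1 else 0 := by
  classical
  set F : ℝ × ℝ → ℂ := fun z => if z.1 ≤ s ∧ s < z.1 + z.2 then 1 else 0
  have hset : MeasurableSet {z : ℝ × ℝ | z.1 ≤ s ∧ s < z.1 + z.2} :=
    (measurableSet_le measurable_fst measurable_const).inter
      (measurableSet_lt measurable_const (measurable_fst.add measurable_snd))
  have hF : Measurable F := Measurable.ite hset measurable_const measurable_const
  have hFB : ∀ z, ‖F z‖ ≤ 1 := by
    intro z
    simp only [F]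
    split_ifs <;> simp
  have hstep : ∀ n, ∫ ω, tailFun S p (s - walk X n ω) ∂P = ∫ ω, F (walk X n ω, X n ω) ∂P := by
    intro n
    rw [integral_walk_step hXm hind hlaw hlam hF hFB n]
    congr 1 with ω
    refine Finset.sum_congr rfl fun a _ => ?_
    congr 1
    simp only [F, indicator, mem_Ico, sub_nonneg, sub_lt_iff_lt_add']
  rw [Finset.sum_congr rfl fun n _ => hstep n, ← integral_finsetSum]
  · have : ∀ᵐ ω ∂P, ∑ n ∈ Finset.range N, F (walk X n ω, X n ω) = if 0 ≤ s then 1 else 0 := by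
      filter_upwards [hX] with ω hω
      exact sum_occupation hr hω hs
    rw [integral_congr_ae this]
    simp
  · intro n _
    exact Integrable.of_bound (hF.comp ((measurable_walk hXm n).prodMk
      (hXm n))).aestronglyMeasurable 1 (Eventually.of_forall fun ω => hFB _)

lemma norm_overshootMean_le (hg : ∀ x, ‖g x‖ ≤ B) (t : ℝ) : ‖overshootMean P X g t‖ ≤ B := by
  rw [overshootMean]
  split_ifs
  · refine (norm_integral_le_of_norm_le_const (Eventually.of_forall fun ω => hg _)).trans ?_
    simp
  · simpa using (norm_nonneg _).trans (hg 0)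

/-- At each `t` the finite renewal sums are eventually constant in the number of terms, and each is
measurable by Fubini. -/
lemma measurable_overshootMean (hXm : ∀ n, Measurable (X n)) (hind : iIndepFun X P)
    (hlaw : ∀ n, P.map (X n) = lam)
    (hlam : ∀ f : ℝ → ℂ, ∫ x, f x ∂lam = ∑ a ∈ S, (p a : ℂ) * f a)
    (hr : 0 < r) (hX : ∀ᵐ ω ∂P, ∀ n, r ≤ X n ω) (hgm : Measurable g) (hg : ∀ x, ‖g x‖ ≤ B) :
    Measurable (overshootMean P X g) := by
  refine measurable_of_tendsto_metrizable (f := fun N t =>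
    ∑ n ∈ Finset.range N, ∫ ω, ladderFun S p g (t - walk X n ω) ∂P) (fun N => ?_)
    (tendsto_pi_nhds.2 fun t => ?_)
  · refine Finset.measurable_fun_sum _ fun n _ => ?_
    have h : StronglyMeasurable (fun z : ℝ × Ω => ladderFun S p g (z.1 - walk X n z.2)) :=
      ((measurable_ladderFun hgm).comp (measurable_fst.sub
        ((measurable_walk hXm n).comp measurable_snd))).stronglyMeasurable
    exact h.integral_prod_right.measurable
  · obtain ⟨N, hN⟩ := exists_nat_ge (t / r)
    refine tendsto_const_nhds.congr' ?_
    filter_upwards [eventually_ge_atTop N] with n hn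
    refine overshootMean_eq_sum hXm hind hlaw hlam hr hX hgm hg ?_
    rw [← div_le_iff₀ hr]
    exact hN.trans (by exact_mod_cast hn)

/-- The integrated renewal equation. -/
theorem integral_tailFun_mul_overshootMean (hp : ∀ a ∈ S, 0 ≤ p a) (hsum : ∑ a ∈ S, p a = 1)
    (hM : ∀ a ∈ S, a ≤ M) (hXm : ∀ n, Measurable (X n)) (hind : iIndepFun X P)
    (hlaw : ∀ n, P.map (X n) = lam)
    (hlam : ∀ f : ℝ → ℂ, ∫ x, f x ∂lam = ∑ a ∈ S, (p a : ℂ) * f a)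
    (hr : 0 < r) (hX : ∀ᵐ ω ∂P, ∀ n, r ≤ X n ω) (hgm : Measurable g) (hg : ∀ x, ‖g x‖ ≤ B)
    (s : ℝ) :
    ∫ y, tailFun S p y * overshootMean P X g (s - y) = ∫ z in Iic s, ladderFun S p g z := by
  -- One truncation serves for all `y ≥ 0` and all `z > 0`, since then `s - y ≤ s` and `s - z < s`;
  -- elsewhere the first factor vanishes.
  obtain ⟨N, hN⟩ := exists_nat_gt (s / r)
  rw [div_lt_iff₀ hr] at hN
  have hG := measurable_ladderFun (S := S) (p := p) hgm
  have hT := measurable_tailFun (S := S) (p := p)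
  have hone : Integrable (fun _ : Ω => (1 : ℂ)) P := integrable_const 1
  have hint1 : ∀ n, Integrable (fun z : ℝ × Ω =>
      tailFun S p z.1 * ladderFun S p g (s - z.1 - walk X n z.2)) (volume.prod P) := by
    intro n
    refine (((integrable_tailFun (S := S) (p := p)).mul_prod hone).mul_bdd (c := B)
      (g := fun z : ℝ × Ω => ladderFun S p g (s - z.1 - walk X n z.2)) ?_
      (Eventually.of_forall fun z => norm_ladderFun_le hp hsum hg _)).congr
      (Eventually.of_forall fun z => by simp)
    exact (hG.comp ((measurable_const.sub measurable_fst).sub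
      ((measurable_walk hXm n).comp measurable_snd))).aestronglyMeasurable
  have hint2 : ∀ n, Integrable (fun z : ℝ × Ω =>
      ladderFun S p g z.1 * tailFun S p (s - z.1 - walk X n z.2)) (volume.prod P) := by
    intro n
    refine (((integrable_ladderFun hp hsum hM hgm hg).mul_prod hone).mul_bdd (c := 1)
      (g := fun z : ℝ × Ω => tailFun S p (s - z.1 - walk X n z.2)) ?_
      (Eventually.of_forall fun z => norm_tailFun_le hp hsum _)).congr
      (Eventually.of_forall fun z => by simp)
    exact (hT.comp ((measurable_const.sub measurable_fst).sub
      ((measurable_walk hXm n).comp measurable_snd))).aestronglyMeasurable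
  calc ∫ y, tailFun S p y * overshootMean P X g (s - y)
      = ∫ y, ∑ n ∈ Finset.range N,
          ∫ ω, tailFun S p y * ladderFun S p g (s - y - walk X n ω) ∂P := by
        congr 1 with y
        rcases lt_or_ge y 0 with hy | hy
        · simp [tailFun_of_neg hy]
        · rw [overshootMean_eq_sum hXm hind hlaw hlam hr hX hgm hg
            (by linarith : s - y ≤ N * r), Finset.mul_sum]
          simp only [integral_const_mul]
    _ = ∑ n ∈ Finset.range N,
          ∫ y, ∫ ω, tailFun S p y * ladderFun S p g (s - y - walk X n ω) ∂P :=
        integral_finsetSum _ fun n _ => (hint1 n).integral_prod_left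
    _ = ∑ n ∈ Finset.range N,
          ∫ z, ∫ ω, ladderFun S p g z * tailFun S p (s - z - walk X n ω) ∂P := by
        refine Finset.sum_congr rfl fun n _ => ?_
        refine (integral_integral_swap (hint1 n)).trans
          (Eq.trans ?_ (integral_integral_swap (hint2 n)).symm)
        congr 1 with ω
        -- The reflection `y ↦ s - S_n - y` exchanges the roles of the tail function and the
        -- one-step contribution.
        rw [← integral_sub_left_eq_self _ volume (s - walk X n ω)]
        congr 1 with z
        rw [mul_comm]
        congr 2 <;> ring
    _ = ∫ z, ∑ n ∈ Finset.range N,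
          ∫ ω, ladderFun S p g z * tailFun S p (s - z - walk X n ω) ∂P :=
        (integral_finsetSum _ fun n _ => (hint2 n).integral_prod_left).symm
    _ = ∫ z, (Iic s).indicator (ladderFun S p g) z := by
        congr 1 with z
        rcases le_or_gt z 0 with hz | hz
        · simp [ladderFun_of_nonpos hz, indicator]
        · simp only [integral_const_mul]
          rw [← Finset.mul_sum, sum_integral_tailFun hXm hind hlaw hlam hr hX
            (by linarith : s - z < N * r)]
          by_cases h : z ≤ s <;> simp [h]
    _ = _ := integral_indicator measurableSet_Iic

end

/-! ### Atomic laws, the bump, and passage positions -/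

/-- `lam = ∑ a ∈ S, p a δ_a` is a probability measure with atoms in `[r, M]`, where `r > 0`. -/
structure IsAtomic (S : Finset ℝ) (p : ℝ → ℝ) (r M : ℝ) (lam : Measure ℝ) : Prop where
  nonneg : ∀ a ∈ S, 0 ≤ p a
  sum_eq_one : ∑ a ∈ S, p a = 1
  pos : 0 < r
  le : ∀ a ∈ S, r ≤ a
  le_max : ∀ a ∈ S, a ≤ M
  integral_eq : ∀ f : ℝ → ℂ, ∫ x, f x ∂lam = ∑ a ∈ S, (p a : ℂ) * f a
  ae_mem : ∀ᵐ x ∂lam, x ∈ S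

/-- The steps `X` are i.i.d. with law `lam`. -/
structure IsIIDSteps {Ω : Type*} [MeasurableSpace Ω] (lam : Measure ℝ) (P : Measure Ω)
    (X : ℕ → Ω → ℝ) : Prop where
  measurable : ∀ n, Measurable (X n)
  indep : iIndepFun X P
  law : ∀ n, P.map (X n) = lam

/-- The limit `σ⁻¹ ∫_0^∞ g(x) λ((x, ∞)) dx`. -/
noncomputable def limitMean (S : Finset ℝ) (p : ℝ → ℝ) (g : ℝ → ℂ) : ℂ :=
  ((∑ a ∈ S, p a * a : ℝ) : ℂ)⁻¹ * ∫ x in Ioi 0, g x * tailFun S p x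

section

variable {S : Finset ℝ} {p : ℝ → ℝ} {r M : ℝ} {lam : Measure ℝ}

lemma IsAtomic.pos_of_mem (h : IsAtomic S p r M lam) : ∀ a ∈ S, 0 < a := fun a ha =>
  h.pos.trans_le (h.le a ha)

lemma IsAtomic.exists_pos (h : IsAtomic S p r M lam) : ∃ a ∈ S, 0 < p a := by
  by_contra! h0
  have := Finset.sum_nonpos h0
  rw [h.sum_eq_one] at this
  linarith

lemma IsAtomic.max_pos (h : IsAtomic S p r M lam) : 0 < M := by
  obtain ⟨a, ha, -⟩ := h.exists_pos
  exact (h.pos_of_mem a ha).trans_le (h.le_max a ha)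

lemma IsAtomic.mean_pos (h : IsAtomic S p r M lam) : 0 < ∑ a ∈ S, p a * a := by
  obtain ⟨a, ha, hpa⟩ := h.exists_pos
  exact Finset.sum_pos' (fun a ha => mul_nonneg (h.nonneg a ha) (h.pos_of_mem a ha).le)
    ⟨a, ha, mul_pos hpa (h.pos_of_mem a ha)⟩

lemma IsAtomic.integral_norm_tailFun_le (h : IsAtomic S p r M lam) :
    ∫ x, ‖tailFun S p x‖ ≤ M := by
  have h1 : ∀ x, ‖tailFun S p x‖ ≤ (Icc 0 M).indicator (fun _ => (1 : ℝ)) x := by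
    intro x
    by_cases hx : x ∈ Icc 0 M
    · simpa [hx] using norm_tailFun_le h.nonneg h.sum_eq_one x
    · rw [indicator_of_notMem hx]
      rcases lt_or_ge x 0 with h0 | h0
      · rw [tailFun_of_neg h0, norm_zero]
      · rw [tailFun_of_le h.le_max (le_of_not_ge fun h1 => hx ⟨h0, h1⟩), norm_zero]
  have h2 : Integrable ((Icc 0 M).indicator fun _ => (1 : ℝ)) :=
    (integrableOn_const (by simp)).integrable_indicator measurableSet_Icc
  refine (integral_mono (integrable_tailFun.norm) h2 h1).trans ?_
  rw [integral_indicator measurableSet_Icc]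
  simp [h.max_pos.le]

lemma IsAtomic.integral_norm_ladderFun_le (h : IsAtomic S p r M lam) {g : ℝ → ℂ} {B : ℝ}
    (hgm : Measurable g) (hg : ∀ x, ‖g x‖ ≤ B) :
    ∫ x, ‖ladderFun S p g x‖ ≤ B * M := by
  have h2 : Integrable ((Icc 0 M).indicator fun _ => B) :=
    (integrableOn_const (by simp)).integrable_indicator measurableSet_Icc
  refine (integral_mono (integrable_ladderFun h.nonneg h.sum_eq_one h.le_max hgm hg).norm h2
    (norm_ladderFun_le_indicator h.nonneg h.sum_eq_one h.le_max hg)).trans ?_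
  rw [integral_indicator measurableSet_Icc]
  simp [h.max_pos.le, mul_comm]

/-- A support in `[0, 1]` makes the average one-sided: only times in `[t' - δ, t']` are seen, so
shifting `t'` by `±δ` allows monotone comparison. -/
lemma exists_bump : ∃ (φ : 𝓢(ℝ, ℂ)) (f : ℝ → ℝ), (∀ v, φ v = f v) ∧ (∀ v, 0 ≤ f v) ∧
    Integrable f ∧ (∫ v, f v = 1) ∧ ∀ v, v ∉ Icc (0 : ℝ) 1 → f v = 0 := by
  let b : ContDiffBump (1 / 2 : ℝ) := ⟨1 / 4, 1 / 2, by norm_num, by norm_num⟩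
  have hsupp : HasCompactSupport (fun v => ((b.normed volume v : ℝ) : ℂ)) :=
    (b.hasCompactSupport_normed (μ := volume)).comp_left (g := fun x : ℝ => (x : ℂ)) (by simp)
  have hsmooth : ContDiff ℝ ((⊤ : ℕ∞) : WithTop ℕ∞) (fun v => ((b.normed volume v : ℝ) : ℂ)) :=
    Complex.ofRealCLM.contDiff.comp b.contDiff_normed
  refine ⟨hsupp.toSchwartzMap hsmooth, b.normed volume, fun v => rfl, b.nonneg_normed,
    b.integrable_normed, b.integral_normed, fun v hv => ?_⟩
  by_contra h0
  have : v ∈ Function.support (b.normed volume) := h0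
  rw [b.support_normed_eq, Real.ball_eq_Ioo] at this
  exact hv ⟨by have := this.1; simp only [b] at this; linarith,
    by have := this.2; simp only [b] at this; linarith⟩

section

variable {Ω : Type*} [MeasurableSpace Ω] {P : Measure Ω} {X : ℕ → Ω → ℝ}

lemma IsIIDSteps.ae_step_mem (hX : IsIIDSteps lam P X) (h : IsAtomic S p r M lam) :
    ∀ᵐ ω ∂P, ∀ n, r ≤ X n ω ∧ X n ω ≤ M := by
  filter_upwards [ae_forall_step hX.measurable hX.law h.ae_mem] with ω hω n
  exact ⟨h.le _ (hω n), h.le_max _ (hω n)⟩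

lemma IsIIDSteps.aestronglyMeasurable_overshoot (hX : IsIIDSteps lam P X)
    (h : IsAtomic S p r M lam) {g : ℝ → ℂ} (hgm : Measurable g) {t : ℝ} (ht : 0 < t) :
    AEStronglyMeasurable (fun ω => g (overshoot X t ω)) P := by
  classical
  obtain ⟨N, hN⟩ := exists_nat_ge (t / r)
  have hw := fun n => measurable_walk hX.measurable n
  have hm : Measurable fun ω => ∑ n ∈ Finset.range N,
      (if walk X n ω < t ∧ t ≤ walk X n ω + X n ω then g (walk X n ω + X n ω - t) else 0) := by
    refine Finset.measurable_fun_sum _ fun n _ => Measurable.ite ?_ ?_ measurable_const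
    · exact (measurableSet_lt (hw n) measurable_const).inter
        (measurableSet_le measurable_const ((hw n).add (hX.measurable n)))
    · exact hgm.comp (((hw n).add (hX.measurable n)).sub measurable_const)
  refine hm.aestronglyMeasurable.congr ?_
  filter_upwards [hX.ae_step_mem h] with ω hω
  rw [sum_overshoot h.pos (fun n => (hω n).1) g ((div_le_iff₀ h.pos).1 hN), if_pos ht]

lemma IsIIDSteps.overshoot_mem (hX : IsIIDSteps lam P X) (h : IsAtomic S p r M lam) {t : ℝ}
    (ht : 0 < t) : ∀ᵐ ω ∂P, overshoot X t ω ∈ Icc 0 M := by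
  filter_upwards [hX.ae_step_mem h] with ω hω
  exact ⟨overshoot_nonneg h.pos (fun n => (hω n).1) t,
    overshoot_le h.pos (fun n => (hω n).1) (fun n => (hω n).2) ht⟩

/-- The expected position of the walk when it passes `t`. -/
noncomputable def passageMean {Ω : Type*} [MeasurableSpace Ω] (P : Measure Ω) (X : ℕ → Ω → ℝ) (t : ℝ) : ℝ :=
  ∫ ω, walk X (stopTime X t ω) ω ∂P

variable [IsProbabilityMeasure P]

lemma IsIIDSteps.integrable_comp_overshoot (hX : IsIIDSteps lam P X) (h : IsAtomic S p r M lam)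
    {g : ℝ → ℂ} (hgm : Measurable g) {B : ℝ} (hg : ∀ x ∈ Icc 0 M, ‖g x‖ ≤ B) {t : ℝ} (ht : 0 < t) :
    Integrable (fun ω => g (overshoot X t ω)) P := by
  refine Integrable.of_bound (hX.aestronglyMeasurable_overshoot h hgm ht) B ?_
  filter_upwards [hX.overshoot_mem h ht] with ω hω
  exact hg _ hω

lemma IsIIDSteps.integrable_overshoot (hX : IsIIDSteps lam P X) (h : IsAtomic S p r M lam)
    {t : ℝ} (ht : 0 < t) : Integrable (fun ω => overshoot X t ω) P := by
  have := hX.integrable_comp_overshoot h (g := fun x => (x : ℂ)) (by fun_prop) (B := M)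
    (fun x hx => by
      rw [Complex.norm_real, Real.norm_of_nonneg hx.1]
      exact hx.2) ht
  exact this.re

lemma IsIIDSteps.integrable_walk_stopTime (hX : IsIIDSteps lam P X) (h : IsAtomic S p r M lam)
    {t : ℝ} (ht : 0 < t) : Integrable (fun ω => walk X (stopTime X t ω) ω) P := by
  refine ((hX.integrable_overshoot h ht).add (integrable_const t)).congr
    (Eventually.of_forall fun ω => ?_)
  simp [overshoot]

lemma IsIIDSteps.passageMean_mono (hX : IsIIDSteps lam P X) (h : IsAtomic S p r M lam)
    {s t : ℝ} (hs : 0 < s) (hst : s ≤ t) : passageMean P X s ≤ passageMean P X t := by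
  refine integral_mono_ae (hX.integrable_walk_stopTime h hs)
    (hX.integrable_walk_stopTime h (hs.trans_le hst)) ?_
  filter_upwards [hX.ae_step_mem h] with ω hω
  exact walk_stopTime_mono h.pos (fun n => (hω n).1) hst

/-- Links the mollified estimate for a particular test function to a monotone function of time. The
cutoff makes the identity bounded without affecting the overshoot. -/
lemma IsIIDSteps.overshootMean_id (hX : IsIIDSteps lam P X) (h : IsAtomic S p r M lam)
    {t : ℝ} (ht : 0 < t) :
    overshootMean P X ((Icc 0 M).indicator fun x => (x : ℂ)) t = (passageMean P X t - t : ℝ) := by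
  have h1 : passageMean P X t - t = ∫ ω, overshoot X t ω ∂P := by
    simp only [overshoot]
    rw [integral_sub (hX.integrable_walk_stopTime h ht) (integrable_const t)]
    simp [passageMean]
  rw [overshootMean, if_pos ht, h1, ← integral_complex_ofReal]
  refine integral_congr_ae ?_
  filter_upwards [hX.overshoot_mem h ht] with ω hω
  exact indicator_of_mem hω _

/-- Variation of the overshoot expectation in terms of the mean passage positions. -/
lemma IsIIDSteps.norm_overshootMean_sub_le (hX : IsIIDSteps lam P X) (h : IsAtomic S p r M lam)
    {g : ℝ → ℂ} {B : ℝ} (hgm : Measurable g) (hg : ∀ x, ‖g x‖ ≤ B)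
    (hlip : ∀ x ∈ Icc 0 M, ∀ y ∈ Icc 0 M, ‖g x - g y‖ ≤ B * |x - y|) {t u : ℝ} (ht : 0 < t)
    (hu : 0 ≤ u) :
    ‖overshootMean P X g (t + u) - overshootMean P X g t‖ ≤
      B * u + 2 * B / r * (passageMean P X (t + u) - passageMean P X t) := by
  have hB : 0 ≤ B := (norm_nonneg _).trans (hg 0)
  have hr := h.pos
  have htu : 0 < t + u := by linarith
  have hi : ∀ {s : ℝ}, 0 < s → Integrable (fun ω => g (overshoot X s ω)) P := fun hs =>
    hX.integrable_comp_overshoot h hgm (fun x _ => hg x) hs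
  have hwi : Integrable (fun ω => walk X (stopTime X (t + u) ω) ω -
      walk X (stopTime X t ω) ω) P :=
    (hX.integrable_walk_stopTime h htu).sub (hX.integrable_walk_stopTime h ht)
  have hbi : Integrable (fun ω => B * u + 2 * B / r *
      (walk X (stopTime X (t + u) ω) ω - walk X (stopTime X t ω) ω)) P :=
    (integrable_const _).add (hwi.const_mul _)
  rw [overshootMean, overshootMean, if_pos htu, if_pos ht, ← integral_sub (hi htu) (hi ht)]
  have hle := norm_integral_le_of_norm_le (f := fun ω =>
    g (overshoot X (t + u) ω) - g (overshoot X t ω)) hbi (by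
      filter_upwards [hX.ae_step_mem h, hX.overshoot_mem h ht, hX.overshoot_mem h htu]
        with ω hω h1 h2
      have hω' := fun n => (hω n).1
      -- If the overshoot is below `u`, the passage position moves by at least `r`, which pays for
      -- the trivial bound `2B`; otherwise the Lipschitz bound applies.
      by_cases hou : overshoot X t ω < u
      · have h3 := le_walk_stopTime_sub hr hω' hou
        calc ‖g (overshoot X (t + u) ω) - g (overshoot X t ω)‖ ≤ B + B :=
              (norm_sub_le _ _).trans (add_le_add (hg _) (hg _))
          _ = 2 * B / r * r := by field_simp; ring
          _ ≤ 2 * B / r * (walk X (stopTime X (t + u) ω) ω - walk X (stopTime X t ω) ω) := by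
              gcongr
          _ ≤ _ := le_add_of_nonneg_left (by positivity)
      · have h3 := overshoot_add hr hω' hu (not_lt.1 hou)
        have h4 := walk_stopTime_mono hr hω' (by linarith : t ≤ t + u)
        simp only at h4
        calc ‖g (overshoot X (t + u) ω) - g (overshoot X t ω)‖
            ≤ B * |overshoot X (t + u) ω - overshoot X t ω| := hlip _ h2 _ h1
          _ = B * u := by rw [h3, sub_sub_cancel_left, abs_neg, abs_of_nonneg hu]
          _ ≤ _ := le_add_of_nonneg_right (mul_nonneg (by positivity) (sub_nonneg.2 h4)))
  refine hle.trans (le_of_eq ?_)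
  have hsub : ∫ ω, (walk X (stopTime X (t + u) ω) ω - walk X (stopTime X t ω) ω) ∂P =
      passageMean P X (t + u) - passageMean P X t :=
    integral_sub (hX.integrable_walk_stopTime h htu) (hX.integrable_walk_stopTime h ht)
  rw [integral_add (integrable_const _) (hwi.const_mul _), integral_const_mul (2 * B / r), hsub]
  simp

variable [IsProbabilityMeasure lam]

lemma IsIIDSteps.measurable_overshootMean (hX : IsIIDSteps lam P X) (h : IsAtomic S p r M lam)
    {g : ℝ → ℂ} {B : ℝ} (hgm : Measurable g) (hg : ∀ x, ‖g x‖ ≤ B) :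
    Measurable (overshootMean P X g) :=
  StoppedRenewal.measurable_overshootMean hX.measurable hX.indep hX.law h.integral_eq h.pos
    ((hX.ae_step_mem h).mono fun _ hω n => (hω n).1) hgm hg

/-! ### The mollified estimate for the overshoot -/

/-- The mollified overshoot expectation is close to its limit. -/
theorem exists_mollified_overshootMean (h : IsAtomic S p r M lam) {l c b₀ : ℝ} (hl : 0 < l)
    (hc : 0 < c) (hL : ∀ b, b₀ ≤ |b| → c < |b| ^ l * ‖1 - expSum S p b‖) {φ : 𝓢(ℝ, ℂ)}
    (hφ : ∀ v, v ∉ Icc (0 : ℝ) 1 → φ v = 0) :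
    ∃ K : ℝ, 0 ≤ K ∧ ∀ (Ω : Type*) [MeasurableSpace Ω] (P : Measure Ω) [IsProbabilityMeasure P]
      (X : ℕ → Ω → ℝ), IsIIDSteps lam P X → ∀ t t' : ℝ, M + 1 < t → t - scale l t ≤ t' →
      ∀ (g : ℝ → ℂ) (B : ℝ), Measurable g → (∀ x, ‖g x‖ ≤ B) →
      ‖∫ v, φ v * (overshootMean P X g (t' - scale l t * v) - limitMean S p g)‖ ≤
        K * scale l t * B := by
  set σ := ∑ a ∈ S, p a * a with hσdef
  have hσ : 0 < σ := h.mean_pos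
  have hM := h.max_pos
  obtain ⟨K, hK0, hK⟩ := exists_mollified_bound h.pos_of_mem h.nonneg h.sum_eq_one hl hc hL φ hM.le
  refine ⟨K * (M + σ⁻¹ * M * M), by positivity, fun Ω _ P _ X hX t t' ht ht' g B hgm hg => ?_⟩
  have hB : 0 ≤ B := (norm_nonneg _).trans (hg 0)
  have hGi := integrable_ladderFun h.nonneg h.sum_eq_one h.le_max hgm hg
  have hTi : Integrable (tailFun S p) := integrable_tailFun
  set G := ladderFun S p g
  set T := tailFun S p
  set L := limitMean S p g with hLdef
  have hLeq : L = (σ : ℂ)⁻¹ * ∫ y, G y := by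
    rw [hLdef, limitMean, integral_ladderFun h.pos_of_mem hgm hg]
  have hGn : ‖∫ y, G y‖ ≤ B * M :=
    (norm_integral_le_integral_norm _).trans (h.integral_norm_ladderFun_le hgm hg)
  have hLn : ‖L‖ ≤ σ⁻¹ * (B * M) := by
    rw [hLeq, norm_mul, norm_inv, Complex.norm_real, Real.norm_of_nonneg hσ.le]
    gcongr
  have hTσ : ∫ y, T y = (σ : ℂ) := by
    have h1 := fourier_tailFun_zero (p := p) h.pos_of_mem
    rw [Real.fourier_real_eq] at h1
    simpa [T, hσdef] using h1
  set ψ := overshootMean P X g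
  have hψm : Measurable ψ := hX.measurable_overshootMean h hgm hg
  have hψB : ∀ x, ‖ψ x‖ ≤ B := norm_overshootMean_le hg
  set H : ℝ → ℂ := fun x => ψ x - (Ioi 0).indicator (fun _ => L) x with hHdef
  set W : ℝ → ℂ := fun s => (∫ z in Iic s, G z) - (∫ y in Iio s, T y) * L with hWdef
  have hHm : Measurable H := hψm.sub (measurable_const.indicator measurableSet_Ioi)
  have hind : ∀ x, ‖(Ioi (0 : ℝ)).indicator (fun _ => L) x‖ ≤ ‖L‖ := fun x =>
    norm_indicator_le_norm_self (fun _ => L) x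
  have hHB : ∀ x, ‖H x‖ ≤ B + ‖L‖ := fun x =>
    (norm_sub_le _ _).trans (add_le_add (hψB x) (hind x))
  have hHW : ∀ s, ∫ y, T y * H (s - y) = W s := by
    intro s
    simp only [hHdef, mul_sub]
    rw [integral_sub]
    · rw [integral_tailFun_mul_overshootMean h.nonneg h.sum_eq_one h.le_max hX.measurable hX.indep
        hX.law h.integral_eq h.pos ((hX.ae_step_mem h).mono fun _ hω n => (hω n).1) hgm hg s]
      congr 1
      rw [← integral_mul_const, ← integral_indicator measurableSet_Iio]
      congr 1 with y
      by_cases hy : y < s <;> simp [hy, T]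
    · exact hTi.mul_bdd (hψm.comp (measurable_const.sub measurable_id)).aestronglyMeasurable
        (Eventually.of_forall fun y => hψB _)
    · exact hTi.mul_bdd ((measurable_const.indicator measurableSet_Ioi).comp
        (measurable_const.sub measurable_id)).aestronglyMeasurable
        (Eventually.of_forall fun y => hind _)
  have hWD : ∀ s, ‖W s‖ ≤ (M + σ⁻¹ * M * M) * B := by
    intro s
    have h1 : ‖∫ z in Iic s, G z‖ ≤ B * M :=
      (norm_integral_le_integral_norm _).trans ((setIntegral_le_integral hGi.norm
        (Eventually.of_forall fun _ => norm_nonneg _)).trans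
        (h.integral_norm_ladderFun_le hgm hg))
    have h2 : ‖∫ y in Iio s, T y‖ ≤ M :=
      (norm_integral_le_integral_norm _).trans ((setIntegral_le_integral hTi.norm
        (Eventually.of_forall fun _ => norm_nonneg _)).trans h.integral_norm_tailFun_le)
    calc ‖W s‖ ≤ ‖∫ z in Iic s, G z‖ + ‖∫ y in Iio s, T y‖ * ‖L‖ := by
          rw [← norm_mul]
          exact norm_sub_le _ _
      _ ≤ B * M + M * (σ⁻¹ * (B * M)) := by gcongr
      _ = _ := by ring
  -- Beyond `M` both primitives have reached their totals, and `∫ G - σ L = 0` by the choice of `L`.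
  have hW0 : ∀ s, s ∉ Icc 0 M → W s = 0 := by
    intro s hs
    rcases lt_or_ge s 0 with h0 | h0
    · have h1 : ∫ z in Iic s, G z = 0 := setIntegral_eq_zero_of_forall_eq_zero fun z hz =>
        ladderFun_of_nonpos ((mem_Iic.1 hz).trans h0.le)
      have h2 : ∫ y in Iio s, T y = 0 := setIntegral_eq_zero_of_forall_eq_zero fun z hz =>
        tailFun_of_neg ((mem_Iio.1 hz).trans h0)
      simp only [hWdef, h1, h2, zero_mul, sub_zero]
    · have hs' : M < s := lt_of_not_ge fun h1 => hs ⟨h0, h1⟩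
      have h1 : ∫ z in Iic s, G z = ∫ z, G z :=
        setIntegral_eq_integral_of_forall_compl_eq_zero fun z hz =>
          ladderFun_of_lt h.le_max (hs'.trans (not_le.1 hz))
      have h2 : ∫ y in Iio s, T y = σ := by
        rw [← hTσ]
        exact setIntegral_eq_integral_of_forall_compl_eq_zero fun z hz =>
          tailFun_of_le h.le_max (hs'.le.trans (not_lt.1 hz))
      have hσc : (σ : ℂ) ≠ 0 := by exact_mod_cast hσ.ne'
      simp only [hWdef, h1, h2, hLeq]
      field_simp
      ring
  have hmain := hK t t' ht ht' H W (B + ‖L‖) ((M + σ⁻¹ * M * M) * B) hHm hHB hHW hWD hW0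
  have ht1 : 1 < t := by linarith
  have hδ : 0 < scale l t := scale_pos (by linarith)
  have hδ2 := scale_le_half hl ht1.le
  have heq : ∫ v, φ v * (ψ (t' - scale l t * v) - L) = ∫ v, φ v * H (t' - scale l t * v) := by
    congr 1 with v
    by_cases hv : v ∈ Icc (0 : ℝ) 1
    -- The bump sees only times at least `t - 2δ ≥ t - 1 > 0`, where the cutoff in `H` is invisible.
    · have : 0 < t' - scale l t * v := by nlinarith [hv.1, hv.2]
      rw [hHdef]
      simp only [indicator_of_mem (mem_Ioi.2 this)]
    · rw [hφ v hv, zero_mul, zero_mul]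
  rw [heq]
  exact hmain.trans (le_of_eq (by ring))

end

end

/-! ### Removing the mollification -/

section

variable {S : Finset ℝ} {p : ℝ → ℝ} {r M : ℝ} {lam : Measure ℝ} [IsProbabilityMeasure lam]

/-- The quantitative renewal theorem for the overshoot, for a finitely supported law. -/
theorem exists_overshootMean_bound (h : IsAtomic S p r M lam) {l c b₀ : ℝ} (hl : 0 < l)
    (hc : 0 < c) (hL : ∀ b, b₀ ≤ |b| → c < |b| ^ l * ‖1 - expSum S p b‖) :
    ∃ C : ℝ, 0 ≤ C ∧ ∀ (Ω : Type*) [MeasurableSpace Ω] (P : Measure Ω) [IsProbabilityMeasure P]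
      (X : ℕ → Ω → ℝ), IsIIDSteps lam P X → ∀ t : ℝ, M + 1 < t →
      ∀ (g : ℝ → ℂ) (B : ℝ), Measurable g → (∀ x, ‖g x‖ ≤ B) →
      (∀ x ∈ Icc 0 M, ∀ y ∈ Icc 0 M, ‖g x - g y‖ ≤ B * |x - y|) →
      ‖overshootMean P X g t - limitMean S p g‖ ≤ C * scale l t * B := by
  obtain ⟨φ, f, hφf, hf0, hfi, hf1, hfs⟩ := exists_bump
  obtain ⟨K, hK0, hK⟩ := exists_mollified_overshootMean h hl hc hL (φ := φ)
    (fun v hv => by rw [hφf, hfs v hv, Complex.ofReal_zero])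
  have hr := h.pos
  have hM := h.max_pos
  refine ⟨1 + 2 / r * (2 + 2 * K * M) + K, by positivity,
    fun Ω _ P _ X hX t ht g B hgm hg hlip => ?_⟩
  have hB : 0 ≤ B := (norm_nonneg _).trans (hg 0)
  have ht1 : 1 < t := by linarith
  set δ := scale l t
  have hδ : 0 < δ := scale_pos (by linarith)
  have hδ2 : δ ≤ 1 / 2 := scale_le_half hl ht1.le
  have hφc : ∀ v, φ v = (f v : ℂ) := hφf
  have hfic : Integrable (fun v => (f v : ℂ)) := hfi.ofReal
  have hint : ∀ {g : ℝ → ℂ} {B : ℝ} (_ : Measurable g) (_ : ∀ x, ‖g x‖ ≤ B) (t' : ℝ) (L : ℂ),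
      Integrable (fun v => φ v * (overshootMean P X g (t' - δ * v) - L)) := by
    intro g B hgm hg t' L
    simp only [hφc]
    refine hfic.mul_bdd (c := B + ‖L‖) ?_ (Eventually.of_forall fun v =>
      (norm_sub_le _ _).trans (add_le_add (norm_overshootMean_le hg _) le_rfl))
    exact (((hX.measurable_overshootMean h hgm hg).comp (by fun_prop)).sub
      measurable_const).aestronglyMeasurable
  set Z := passageMean P X
  have hZ : Z t - Z (t - δ) ≤ (2 + 2 * K * M) * δ := by
    set e : ℝ → ℂ := (Icc 0 M).indicator fun x => (x : ℂ)
    have hem : Measurable e := (by fun_prop : Measurable fun x : ℝ => (x : ℂ)).indicator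
      measurableSet_Icc
    have heB : ∀ x, ‖e x‖ ≤ M := by
      intro x
      by_cases hx : x ∈ Icc 0 M
      · simp only [e, indicator_of_mem hx, Complex.norm_real, Real.norm_of_nonneg hx.1]
        exact hx.2
      · simp only [e, indicator_of_notMem hx, norm_zero]
        exact hM.le
    -- The same `δ` is used around `t + δ` and `t - δ`; this is why the mollified bound separates
    -- the centre `t'` from the time fixing the scale.
    have h1 := hK Ω P X hX t (t + δ) ht (by linarith) e M hem heB
    have h2 := hK Ω P X hX t (t - δ) ht le_rfl e M hem heB
    set q : ℝ → ℝ := fun v => f v * (Z (t + δ - δ * v) - Z (t - δ - δ * v) - 2 * δ)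
    have hq : ∀ v, φ v * (overshootMean P X e (t + δ - δ * v) - limitMean S p e) -
        φ v * (overshootMean P X e (t - δ - δ * v) - limitMean S p e) = (q v : ℂ) := by
      intro v
      by_cases hv : v ∈ Icc (0 : ℝ) 1
      · rw [hX.overshootMean_id h (by nlinarith [hv.1, hv.2] : 0 < t + δ - δ * v),
          hX.overshootMean_id h (by nlinarith [hv.1, hv.2] : 0 < t - δ - δ * v), hφc]
        simp only [q]
        push_cast
        ring
      · simp only [q, hφc, hfs v hv]
        simp
    have hqi : Integrable (fun v => (q v : ℂ)) :=
      ((hint hem heB (t + δ) _).sub (hint hem heB (t - δ) _)).congr (Eventually.of_forall hq)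
    have hqi' : Integrable q := hqi.re
    have hqn : ∫ v, q v ≤ 2 * (K * δ * M) := by
      have h3 : ‖∫ v, (q v : ℂ)‖ ≤ 2 * (K * δ * M) := by
        simp only [← hq]
        rw [integral_sub (hint hem heB _ _) (hint hem heB _ _), two_mul]
        exact (norm_sub_le _ _).trans (add_le_add h1 h2)
      rw [integral_complex_ofReal, Complex.norm_real] at h3
      exact (le_abs_self _).trans h3
    -- By monotonicity of `Z` the two averages enclose `Z t` and `Z (t - δ)`; the term `2δ` is the
    -- distance between the two centres.
    have hlow : ∫ v, f v * (Z t - Z (t - δ) - 2 * δ) ≤ ∫ v, q v := by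
      refine integral_mono (hfi.mul_const _) hqi' fun v => ?_
      by_cases hv : v ∈ Icc (0 : ℝ) 1
      · have h3 : Z t ≤ Z (t + δ - δ * v) :=
          hX.passageMean_mono h (by linarith) (by nlinarith [hv.1, hv.2])
        have h4 : Z (t - δ - δ * v) ≤ Z (t - δ) :=
          hX.passageMean_mono h (by nlinarith [hv.1, hv.2]) (by nlinarith [hv.1, hv.2])
        exact mul_le_mul_of_nonneg_left (by linarith) (hf0 v)
      · simp only [q, hfs v hv, zero_mul, le_refl]
    rw [integral_mul_const, hf1] at hlow
    linarith
  set ψ := overshootMean P X g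
  set L := limitMean S p g
  have hvar : ∀ v ∈ Icc (0 : ℝ) 1,
      ‖ψ t - ψ (t - δ * v)‖ ≤ (1 + 2 / r * (2 + 2 * K * M)) * δ * B := by
    intro v hv
    have hδv : 0 ≤ δ * v := mul_nonneg hδ.le hv.1
    have hδv' : δ * v ≤ δ := mul_le_of_le_one_right hδ.le hv.2
    have h1 := hX.norm_overshootMean_sub_le h hgm hg hlip (t := t - δ * v) (u := δ * v)
      (by linarith) hδv
    rw [sub_add_cancel] at h1
    have h2 : Z (t - δ) ≤ Z (t - δ * v) :=
      hX.passageMean_mono h (by linarith) (by linarith)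
    calc ‖ψ t - ψ (t - δ * v)‖ ≤ B * (δ * v) + 2 * B / r * (Z t - Z (t - δ * v)) := h1
      _ ≤ B * δ + 2 * B / r * ((2 + 2 * K * M) * δ) := by
          gcongr
          linarith
      _ = _ := by ring
  have hdiff : Integrable (fun v => φ v * (ψ t - ψ (t - δ * v))) := by
    refine ((hint hgm hg t (ψ t)).neg).congr (Eventually.of_forall fun v => ?_)
    simp only [Pi.neg_apply, ψ]
    ring
  -- Since the bump has integral one, the error is the variation of `ψ` over the window plus the
  -- mollified error.
  have hsplit : ψ t - L = (∫ v, φ v * (ψ t - ψ (t - δ * v))) +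
      ∫ v, φ v * (ψ (t - δ * v) - L) := by
    rw [← integral_add hdiff (hint hgm hg t L)]
    calc ψ t - L = ∫ v, (f v : ℂ) * (ψ t - L) := by
          rw [integral_mul_const, integral_complex_ofReal, hf1, Complex.ofReal_one, one_mul]
      _ = _ := by
          congr 1 with v
          rw [← mul_add, hφc]
          congr 1
          ring
  have hfirst : ‖∫ v, φ v * (ψ t - ψ (t - δ * v))‖ ≤
      (1 + 2 / r * (2 + 2 * K * M)) * δ * B := by
    have h1 := norm_integral_le_of_norm_le (f := fun v => φ v * (ψ t - ψ (t - δ * v)))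
      (hfi.mul_const ((1 + 2 / r * (2 + 2 * K * M)) * δ * B)) (Eventually.of_forall fun v => by
        rw [norm_mul, hφc, Complex.norm_real, Real.norm_of_nonneg (hf0 v)]
        by_cases hv : v ∈ Icc (0 : ℝ) 1
        · exact mul_le_mul_of_nonneg_left (hvar v hv) (hf0 v)
        · rw [hfs v hv, zero_mul, zero_mul])
    rwa [integral_mul_const, hf1, one_mul] at h1
  have hsecond := hK Ω P X hX t t ht (by linarith) g B hgm hg
  rw [hsplit]
  refine (norm_add_le _ _).trans ((add_le_add hfirst hsecond).trans (le_of_eq (by ring)))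

end

/-! ### Finitely supported measures -/

lemma integral_eq_sum_of_finite_support {lam : Measure ℝ} [IsFiniteMeasure lam]
    (hfin : lam.support.Finite) (f : ℝ → ℂ) :
    ∫ x, f x ∂lam = ∑ a ∈ hfin.toFinset, (lam.real {a} : ℂ) * f a := by
  have h1 : lam.restrict (hfin.toFinset : Set ℝ) = lam := by
    apply Measure.restrict_eq_self_of_ae_mem
    simpa using Measure.support_mem_ae (μ := lam)
  conv_lhs => rw [← h1]
  rw [setIntegral_finset]
  · simp [Complex.real_smul]
  · exact IntegrableOn.finset

lemma abs_le_supAbs {K : Set ℝ} (hK : K.Finite) {a : ℝ} (ha : a ∈ K) : |a| ≤ supAbs K :=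
  le_csSup (hK.image _).bddAbove ⟨a, ha, rfl⟩

lemma exists_isAtomic {lam : Measure ℝ} [IsProbabilityMeasure lam] (hpos : ∀ᵐ x ∂lam, 0 < x)
    (hfin : lam.support.Finite) :
    ∃ S : Finset ℝ, ∃ r : ℝ, IsAtomic S (fun a => lam.real {a}) r (supAbs lam.support) lam := by
  classical
  -- Only null points are discarded; the remaining atoms are positive, and the smallest serves as
  -- `r`.
  set S := hfin.toFinset.filter (0 < ·)
  have hae : ∀ᵐ x ∂lam, x ∈ S := by
    filter_upwards [hpos, Measure.support_mem_ae (μ := lam)] with x hx hxs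
    simp [S, hx, hxs]
  have hzero : ∀ a, a ∉ S → lam.real {a} = 0 := by
    intro a ha
    rw [measureReal_eq_zero_iff]
    exact measure_mono_null (fun x hx => by rw [mem_singleton_iff.1 hx]; exact ha) hae
  have hint : ∀ f : ℝ → ℂ, ∫ x, f x ∂lam = ∑ a ∈ S, (lam.real {a} : ℂ) * f a := by
    intro f
    rw [integral_eq_sum_of_finite_support hfin]
    refine (Finset.sum_subset (Finset.filter_subset _ _) fun a _ ha => ?_).symm
    rw [hzero a ha]
    simp
  have hsum : ∑ a ∈ S, lam.real {a} = 1 := by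
    have := hint fun _ => 1
    simp only [integral_const, probReal_univ, one_smul, mul_one] at this
    exact_mod_cast this.symm
  obtain ⟨r, hr, hrS⟩ : ∃ r : ℝ, 0 < r ∧ ∀ a ∈ S, r ≤ a := by
    have hne : S.Nonempty := by
      rw [Finset.nonempty_iff_ne_empty]
      intro h0
      simp [h0] at hsum
    exact ⟨S.min' hne, (Finset.mem_filter.1 (S.min'_mem hne)).2, fun a ha => S.min'_le a ha⟩
  refine ⟨S, r, fun a _ => measureReal_nonneg, hsum, hr, hrS, fun a ha => ?_, hint, hae⟩
  exact (le_abs_self a).trans (abs_le_supAbs hfin (by simpa using (Finset.mem_filter.1 ha).1))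

lemma IsAtomic.laplaceTransform_eq {S : Finset ℝ} {p : ℝ → ℝ} {r M : ℝ} {lam : Measure ℝ}
    (h : IsAtomic S p r M lam) (b : ℝ) :
    laplaceTransform lam (Complex.I * (b : ℂ)) = expSum S p b := h.integral_eq _

lemma IsAtomic.tailFun_eq {S : Finset ℝ} {p : ℝ → ℝ} {r M : ℝ} {lam : Measure ℝ}
    (h : IsAtomic S p r M lam) {x : ℝ} (hx : 0 ≤ x) : tailFun S p x = (lam.real (Ioi x) : ℂ) := by
  have h1 := h.integral_eq ((Ioi x).indicator fun _ => 1)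
  rw [integral_indicator measurableSet_Ioi] at h1
  simp only [integral_const, measureReal_restrict_apply_univ, Complex.real_smul, mul_one] at h1
  rw [h1, tailFun]
  refine Finset.sum_congr rfl fun a _ => ?_
  by_cases ha : x < a <;> simp [ha, hx]

lemma IsWeaklyDiophantine.exists_lower_bound {l : ℝ} {lam : Measure ℝ}
    (h : IsWeaklyDiophantine l lam) : ∃ c b₀ : ℝ, 0 < c ∧ ∀ b : ℝ, b₀ ≤ |b| →
      c < |b| ^ l * ‖1 - laplaceTransform lam (Complex.I * (b : ℂ))‖ := by
  obtain ⟨c, hc0, hc⟩ := EReal.lt_iff_exists_real_btwn.1 h.2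
  have h1 := eventually_lt_of_lt_liminf hc
  rw [hasBasis_cobounded_norm.eventually_iff] at h1
  obtain ⟨b₀, -, hb⟩ := h1
  exact ⟨c, b₀, by exact_mod_cast hc0, fun b hbb => by exact_mod_cast hb hbb⟩

lemma bddAbove_localC1 {g : ℝ → ℂ} (hg : ContDiff ℝ 1 g) (a b : ℝ) :
    BddAbove ((fun x => ‖g x‖ + ‖deriv g x‖) '' Ioo a b) := by
  have hc : Continuous fun x => ‖g x‖ + ‖deriv g x‖ :=
    hg.continuous.norm.add (hg.continuous_deriv le_rfl).norm
  exact ((isCompact_Icc.image hc).bddAbove).mono (image_mono Ioo_subset_Icc_self)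

end StoppedRenewal

/-! ### The theorem -/

open StoppedRenewal in
theorem proposition2p2 (lam : Measure ℝ) [IsProbabilityMeasure lam]
    (hpos : ∀ᵐ x ∂lam, 0 < x) (hfin : lam.support.Finite)
    (l : ℝ) (hdioph : StoppedRenewal.IsWeaklyDiophantine l lam) :
    ∃ C : ℝ, ∀ (Ω : Type*) [MeasurableSpace Ω] (P : Measure Ω) [IsProbabilityMeasure P]
      (X : ℕ → Ω → ℝ), (∀ n, Measurable (X n)) → iIndepFun X P →
      (∀ n, P.map (X n) = lam) →
      ∀ t : ℝ, StoppedRenewal.supAbs lam.support + 1 < t →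
        (∀ᵐ ω ∂P, ∃ n : ℕ, t ≤ StoppedRenewal.walk X n ω) ∧
        ∀ g : ℝ → ℂ, ContDiff ℝ 1 g →
          Integrable (fun ω => g (StoppedRenewal.overshoot X t ω)) P ∧
          ‖(∫ ω, g (StoppedRenewal.overshoot X t ω) ∂P)
              - (1 / (((∫ x, x ∂lam : ℝ)) : ℂ)) *
                ∫ x in Ioi (0 : ℝ), g x * ((lam.real (Ioi x) : ℝ) : ℂ)‖
            ≤ C * t ^ (-(1 / (4 * l + 1))) * StoppedRenewal.localC1Norm lam g := by
  obtain ⟨S, r, h⟩ := exists_isAtomic hpos hfin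
  obtain ⟨c, b₀, hc, hb⟩ := hdioph.exists_lower_bound
  simp only [h.laplaceTransform_eq] at hb
  obtain ⟨C, hC0, hC⟩ := exists_overshootMean_bound h hdioph.1 hc hb
  -- The half comes from the factor `1/2` in `scale`.
  refine ⟨C / 2, fun Ω _ P _ X hXm hind hlaw t ht => ?_⟩
  have hX : IsIIDSteps lam P X := ⟨hXm, hind, hlaw⟩
  set M := supAbs lam.support with hMdef
  have hM := h.max_pos
  have ht0 : 0 < t := by linarith
  refine ⟨?_, fun g hg => ?_⟩
  · filter_upwards [hX.ae_step_mem h] with ω hω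
    exact exists_le_walk h.pos (fun n => (hω n).1) t
  set B := localC1Norm lam g with hBdef
  have hB : ∀ x ∈ Icc 0 M, ‖g x‖ + ‖deriv g x‖ ≤ B := fun x hx =>
    le_csSup (bddAbove_localC1 hg _ _) ⟨x, ⟨by linarith [hx.1], by linarith [hx.2]⟩, rfl⟩
  have hgB : ∀ x ∈ Icc 0 M, ‖g x‖ ≤ B := fun x hx => by linarith [hB x hx, norm_nonneg (deriv g x)]
  have hdB : ∀ x ∈ Icc 0 M, ‖deriv g x‖ ≤ B := fun x hx => by linarith [hB x hx, norm_nonneg (g x)]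
  have hB0 : 0 ≤ B := (norm_nonneg _).trans (hgB 0 ⟨le_rfl, hM.le⟩)
  -- The overshoot lies in `[0, M]` almost surely and the tail function vanishes from `M` on, so
  -- truncating `g` changes neither side, while the local norm bounds the truncation globally.
  set k : ℝ → ℂ := (Icc 0 M).indicator g with hk
  have hkm : Measurable k := hg.continuous.measurable.indicator measurableSet_Icc
  have hkB : ∀ x, ‖k x‖ ≤ B := by
    intro x
    by_cases hx : x ∈ Icc 0 M
    · simpa [hk, hx] using hgB x hx
    · rw [hk, indicator_of_notMem hx, norm_zero]
      exact hB0
  have hlip : ∀ x ∈ Icc 0 M, ∀ y ∈ Icc 0 M, ‖k x - k y‖ ≤ B * |x - y| := by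
    intro x hx y hy
    rw [hk, indicator_of_mem hx, indicator_of_mem hy]
    exact (convex_Icc 0 M).norm_image_sub_le_of_norm_deriv_le
      (fun z _ => (hg.differentiable one_ne_zero) z) hdB hy hx
  refine ⟨hX.integrable_comp_overshoot h hg.continuous.measurable hgB ht0, ?_⟩
  have hmain := hC Ω P X hX t ht k B hkm hkB hlip
  have hmean : overshootMean P X k t = ∫ ω, g (overshoot X t ω) ∂P := by
    rw [overshootMean, if_pos ht0]
    refine integral_congr_ae ?_
    filter_upwards [hX.overshoot_mem h ht0] with ω hω
    exact indicator_of_mem hω _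
  have hσ : ((∫ x, x ∂lam : ℝ) : ℂ) = ((∑ a ∈ S, lam.real {a} * a : ℝ) : ℂ) := by
    rw [← integral_complex_ofReal, h.integral_eq]
    push_cast
    rfl
  have hlim : limitMean S (fun a => lam.real {a}) k = (1 / (((∫ x, x ∂lam : ℝ)) : ℂ)) *
      ∫ x in Ioi (0 : ℝ), g x * ((lam.real (Ioi x) : ℝ) : ℂ) := by
    rw [limitMean, hσ, one_div]
    congr 1
    refine setIntegral_congr_fun measurableSet_Ioi fun x hx => ?_
    rw [← h.tailFun_eq (mem_Ioi.1 hx).le]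
    by_cases hxM : x ≤ M
    · rw [hk, indicator_of_mem (show x ∈ Icc 0 M from ⟨(mem_Ioi.1 hx).le, hxM⟩)]
    · rw [tailFun_of_le h.le_max (not_le.1 hxM).le, mul_zero, mul_zero]
  rw [← hmean, ← hlim]
  exact hmain.trans (le_of_eq (by rw [scale]; ring))
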